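/- A *Floyd function* is a function $f:\mathbb N_{\ge 1}\to\mathbb R_{>0}$ with $\sum_{n\ge1} f(n)<\infty$ for which there is $\lambda>0$ such that $f(n)\ge f(n+1)\ge\lambda f(n)$ for all $n$; put $f(0):=f(1)$. Let $G$ be a group with a finite generating set $S$, and let $d$ be the path metric of its Cayley graph $\Gamma$. Give an edge of $\Gamma$ with end points $g,h$ the length $f(\min(d(1,g),d(1,h)))$, let $d_f$ be the resulting path metric on $\Gamma$ (the infimum of the lengths of paths), and let $\overline\Gamma$ be the Cauchy completion of $(\Gamma,d_f)$. The *Floyd boundary* is $\partial_f(G,S):=\overline\Gamma\setminus\Gamma$ with the subspace topology. A group is *elementary* if it is virtually cyclic (in particular if it is finite). **Theorem.** Let $n,m\ge2$, let $A_1,\dots,A_n$ and $B_1,\dots,B_m$ be nontrivial groups with finite generating sets $S_i\subset A_i$ and $S'_j\subset B_j$, let $G_1=A_1*\dots*A_n$ and $G_2=B_1*\dots*B_m$, and let $f,f'$ be Floyd functions. Assume that at least one of the groups $A_1,\dots,A_n,B_1,\dots,B_m$ is non-elementary. Let $h(G_1)$ be the set of homeomorphism types of the spaces $\partial_f(A_i,S_i)$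 with $A_i$ non-elementary, and let $h(G_2)$ be the set of homeomorphism types of the spaces $\partial_{f'}(B_j,S'_j)$ with $B_j$ non-elementary. Let $T$ and $T'$ be finite generating sets of $G_1$ and $G_2$, such that $T=\bigcup_i S_i$ or $\sup_k f(k)/f(2k)<\infty$, and such that $T'=\bigcup_j S'_j$ or $\sup_k f'(k)/f'(2k)<\infty$. If $h(G_1)=h(G_2)$, then $\partial_f(G_1,T)$ is homeomorphic to $\partial_{f'}(G_2,T')$. -/

import Mathlib

universe u

noncomputable section

/-- A Floyd function: a positive summable function `f` on the positive integers for which there is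
`c > 0` with `f n ≥ f (n + 1) ≥ c * f n`, extended to `0` by `f 0 = f 1`. -/
structure FloydFunction where
  toFun : ℕ → ℝ
  pos : ∀ n, 0 < toFun n
  zero_eq : toFun 0 = toFun 1
  summable : Summable toFun
  ratio : ∃ c : ℝ, 0 < c ∧ ∀ n, toFun (n + 1) ≤ toFun n ∧ c * toFun n ≤ toFun (n + 1)

instance : CoeFun FloydFunction (fun _ => ℕ → ℝ) := ⟨FloydFunction.toFun⟩

/-- `f n / f (2 * n)` is bounded. -/
def FloydFunction.IsDoubling (f : FloydFunction) : Prop :=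
  ∃ D : ℝ, ∀ n, f n / f (2 * n) ≤ D

theorem FloydFunction.antitone (f : FloydFunction) : Antitone f := by
  obtain ⟨c, -, h⟩ := f.ratio
  exact antitone_nat_of_succ_le fun n => (h n).1

/-- A finite generating set of a group. -/
structure GeneratingSet (G : Type*) [Group G] where
  carrier : Set G
  finite : carrier.Finite
  closure_eq_top : Subgroup.closure carrier = ⊤

namespace GeneratingSet

variable {G : Type*} [Group G] (S : GeneratingSet G)

/-- The Cayley graph: `g ≠ h` are adjacent when `h = g * s` or `g = h * s` for some `s ∈ S`. -/
def cayley : SimpleGraph G := SimpleGraph.mulCayley S.carrier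

theorem cayley_adj {g h : G} :
    S.cayley.Adj g h ↔ g ≠ h ∧ ∃ s ∈ S.carrier, g * s = h ∨ g = h * s :=
  SimpleGraph.mulCayley_adj' _ _ _

theorem cayley_reachable_mul (g h : G) : S.cayley.Reachable g (g * h) := by
  have hh : h ∈ Subgroup.closure S.carrier := by rw [S.closure_eq_top]; trivial
  induction hh using Subgroup.closure_induction generalizing g with
  | mem x hx =>
    by_cases hg : g = g * x
    · rw [← hg]
    · exact SimpleGraph.Adj.reachable (S.cayley_adj.2 ⟨hg, x, hx, Or.inl rfl⟩)
  | one => rw [mul_one]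
  | mul x y _ _ hx hy =>
    rw [← mul_assoc]
    exact (hx g).trans (hy (g * x))
  | inv x _ hx =>
    simpa using (hx (g * x⁻¹)).symm

theorem cayley_reachable (g h : G) : S.cayley.Reachable g h := by
  simpa using S.cayley_reachable_mul g (g⁻¹ * h)

/-- The word length `d(1, g)`, `d` being the distance of the Cayley graph. -/
def wordLength (g : G) : ℕ := S.cayley.dist 1 g

/-- The rescaled length `f (d(1, {g, h}))` of an edge with end points `g` and `h`. -/
def edgeLength (f : FloydFunction) (g h : G) : ℝ := f (min (S.wordLength g) (S.wordLength h))

/-- The Floyd length of an edge path of the Cayley graph. -/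
def pathLength (f : FloydFunction) {g h : G} (p : S.cayley.Walk g h) : ℝ :=
  (p.darts.map fun e => S.edgeLength f e.fst e.snd).sum

/-- The Floyd metric `d_f` between two vertices of the Cayley graph. -/
def floydDist (f : FloydFunction) (g h : G) : ℝ :=
  ⨅ p : S.cayley.Walk g h, S.pathLength f p

variable (f : FloydFunction)

theorem edgeLength_comm (g h : G) : S.edgeLength f g h = S.edgeLength f h g := by
  simp only [edgeLength, min_comm]

theorem pathLength_nonneg {g h : G} (p : S.cayley.Walk g h) : 0 ≤ S.pathLength f p := by
  apply List.sum_nonneg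
  simp only [List.mem_map]
  rintro x ⟨e, -, rfl⟩
  exact (f.pos _).le

theorem floydDist_le {g h : G} (p : S.cayley.Walk g h) : S.floydDist f g h ≤ S.pathLength f p :=
  ciInf_le ⟨0, by rintro _ ⟨q, rfl⟩; exact S.pathLength_nonneg f q⟩ p

theorem floydDist_self (g : G) : S.floydDist f g g = 0 :=
  le_antisymm ((S.floydDist_le f SimpleGraph.Walk.nil).trans (by simp [pathLength]))
    (Real.iInf_nonneg fun p => S.pathLength_nonneg f p)

theorem pathLength_reverse {g h : G} (p : S.cayley.Walk g h) :
    S.pathLength f p.reverse = S.pathLength f p := by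
  simp only [pathLength, SimpleGraph.Walk.darts_reverse, List.map_reverse, List.sum_reverse,
    List.map_map]
  congr 1
  apply List.map_congr_left
  intro e _
  exact S.edgeLength_comm f _ _

theorem floydDist_comm_le (g h : G) : S.floydDist f g h ≤ S.floydDist f h g := by
  have : Nonempty (S.cayley.Walk h g) := S.cayley_reachable h g
  refine le_ciInf fun p => ?_
  rw [← S.pathLength_reverse f p]
  exact S.floydDist_le f _

theorem floydDist_triangle (g h k : G) :
    S.floydDist f g k ≤ S.floydDist f g h + S.floydDist f h k := by
  have : Nonempty (S.cayley.Walk g h) := S.cayley_reachable g h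
  have : Nonempty (S.cayley.Walk h k) := S.cayley_reachable h k
  refine le_ciInf_add_ciInf fun p q => (S.floydDist_le f (p.append q)).trans (le_of_eq ?_)
  simp [pathLength, SimpleGraph.Walk.darts_append]

theorem eq_of_floydDist_eq_zero {g h : G} (h0 : S.floydDist f g h = 0) : g = h := by
  by_contra hne
  have : Nonempty (S.cayley.Walk g h) := S.cayley_reachable g h
  have key : f (S.wordLength g) ≤ S.floydDist f g h := by
    refine le_ciInf fun p => ?_
    cases p with
    | nil => exact absurd rfl hne
    | @cons _ k _ e q =>
      have h1 : f (S.wordLength g) ≤ S.edgeLength f g k := f.antitone (min_le_left _ _)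
      have h2 := S.pathLength_nonneg f q
      simp only [pathLength, SimpleGraph.Walk.darts_cons, List.map_cons, List.sum_cons] at h2 ⊢
      exact le_add_of_le_of_nonneg h1 h2
  exact absurd (f.pos (S.wordLength g)) (by rw [h0] at key; exact not_lt.2 key)

end GeneratingSet

/-- The vertex set of the Cayley graph of `G` with respect to `S`, to be equipped with `d_f`. -/
def FloydSpace {G : Type u} [Group G] (_f : FloydFunction) (_S : GeneratingSet G) : Type u := G

instance {G : Type u} [Group G] (f : FloydFunction) (S : GeneratingSet G) :
    MetricSpace (FloydSpace f S) where
  dist := S.floydDist f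
  dist_self := S.floydDist_self f
  dist_comm g h := le_antisymm (S.floydDist_comm_le f g h) (S.floydDist_comm_le f h g)
  dist_triangle := S.floydDist_triangle f
  eq_of_dist_eq_zero := S.eq_of_floydDist_eq_zero f

/-- The Floyd boundary: the complement of the Cayley graph in its Cauchy completion for the Floyd
metric `d_f`, with the subspace topology. The vertices suffice here: the restriction of `d_f` to
vertices is the infimum of the Floyd lengths of edge paths, and the lengths of the edges tend to
`0` away from the identity, so a Cauchy sequence of the graph without a limit in the graph is
equivalent to a Cauchy sequence of vertices without a limit. -/
def floydBoundary {G : Type u} [Group G] (f : FloydFunction) (S : GeneratingSet G) : Type u :=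
  {x : UniformSpace.Completion (FloydSpace f S) //
    x ∉ Set.range ((↑) : FloydSpace f S → UniformSpace.Completion (FloydSpace f S))}

instance {G : Type u} [Group G] (f : FloydFunction) (S : GeneratingSet G) :
    TopologicalSpace (floydBoundary f S) :=
  instTopologicalSpaceSubtype

/-- A group is elementary if it is virtually cyclic (for instance finite). -/
def IsElementary (G : Type*) [Group G] : Prop :=
  ∃ H : Subgroup G, IsCyclic H ∧ H.FiniteIndex

open Monoid in
/-- The union, inside the free product of the groups `A i`, of generating sets of the factors. -/
def GeneratingSet.freeProduct {n : ℕ} {A : Fin n → Type u} [∀ i, Group (A i)]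
    (S : ∀ i, GeneratingSet (A i)) : GeneratingSet (CoprodI A) where
  carrier := ⋃ i, (CoprodI.of : A i →* CoprodI A) '' (S i).carrier
  finite := Set.finite_iUnion fun i => (S i).finite.image _
  closure_eq_top := by
    rw [Subgroup.closure_iUnion]
    have h : ∀ i, Subgroup.closure ((CoprodI.of : A i →* CoprodI A) '' (S i).carrier) =
        (CoprodI.of : A i →* CoprodI A).range := fun i => by
      rw [← MonoidHom.map_closure, (S i).closure_eq_top, MonoidHom.range_eq_map]
    simp_rw [h]
    rw [← CoprodI.range_eq_iSup]
    rw [CoprodI.lift_of']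
    exact MonoidHom.range_eq_top.2 Function.surjective_id

/-- Two topological spaces are equivalent if they are homeomorphic. -/
def homeoSetoid : Setoid TopCat.{u} where
  r X Y := Nonempty (X ≃ₜ Y)
  iseqv := ⟨fun X => ⟨Homeomorph.refl X⟩, fun ⟨e⟩ => ⟨e.symm⟩, fun ⟨e⟩ ⟨e'⟩ => ⟨e.trans e'⟩⟩

/-- Homeomorphism types of topological spaces. -/
def HomeoType : Type (u + 1) := Quotient homeoSetoid.{u}

/-- The homeomorphism type of a space. -/
def homeoType (X : Type u) [TopologicalSpace X] : HomeoType.{u} :=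
  Quotient.mk homeoSetoid (TopCat.of X)

/-- The set of homeomorphism types of the Floyd boundaries of the non-elementary groups among the
`A i`. -/
def nonElementaryTypes (f : FloydFunction) {n : ℕ} {A : Fin n → Type u} [∀ i, Group (A i)]
    (S : ∀ i, GeneratingSet (A i)) : Set HomeoType.{u} :=
  {t | ∃ i, ¬ IsElementary (A i) ∧ t = homeoType (floydBoundary f (S i))}

end

/-! For the generators coming from the factors, the Cayley graph of a free product is a tree of
copies of the Cayley graphs of the factors. The first syllable of `w⁻¹ * x` defines a Lipschitz
projection onto the coset `w * A i`, so each coset contributes a closed copy of the boundary of `A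
i` to the boundary of the product. These copies are disjoint, and their diameters tend to zero
because a coset with shortest element `w` lies within `f.tail` of the length of `w`. For every
infinite factor they occur near every boundary point.

The copies for the non-elementary factors satisfy `IsNullFamily` (`isNullFamily_cosetBoundary`). Two
points in no common copy are separated by the preimage of a clopen set under some projection, and
such a preimage cuts no copy. Elementary factors have finite boundary, hence a countable completion,
whose points are separated by clopen sets; this is why they leave no trace in the homeomorphism
type.

The rest is topology: two compact metric spaces with null families, each containing dense copies of
the members of the other, are homeomorphic (`IsNullFamily.nonempty_homeomorph`). The graph of the
homeomorphism is the intersection of closed relations whose fibres shrink to points. Each relation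
is a finite disjoint union of blocks `coreRel`, thickened graphs of homeomorphisms `Y i ≃ₜ Y' i'`.
To refine a block, both sides are shrunk to thin neighbourhoods of `Y i` and `Y' i'`. The part cut
off consists of finitely many saturated clopen pieces close to points `y`, and each is matched with
a small saturated clopen set close to `φ y`; such sets exist because members have empty interior.
That the pieces can be matched finely is `isRefinable_prod`, an induction on the number of large
members.

For a doubling Floyd function the metrics of two generating sets are bi-Lipschitz equivalent, which
allows arbitrary `T` and `T'`. -/

/-! ### Compact metric spaces with dense null families. -/

section DenseFamily

open Set Metric Topology

/-- A clopen set containing or missing each member of the family `Y`. -/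
def IsSaturatedClopen {Z ι : Type*} [TopologicalSpace Z] (Y : ι → Set Z) (H : Set Z) : Prop :=
  IsClopen H ∧ ∀ i, Y i ⊆ H ∨ Disjoint (Y i) H

/-- A null family of disjoint closed sets with empty interior, such that any two points which do
not lie in a common member are separated by a saturated clopen set. -/
structure IsNullFamily {Z ι : Type*} [MetricSpace Z] (Y : ι → Set Z) : Prop where
  isClosed : ∀ i, IsClosed (Y i)
  nonempty : ∀ i, (Y i).Nonempty
  eq_of_mem : ∀ i j x, x ∈ Y i → x ∈ Y j → i = j
  finite_diam : ∀ ε > 0, {i | ε ≤ diam (Y i)}.Finite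
  interior_eq_empty : ∀ i, interior (Y i) = ∅
  separated : ∀ x y, (∀ H, IsSaturatedClopen Y H → x ∈ H → y ∈ H) → x = y ∨ ∃ i, x ∈ Y i ∧ y ∈ Y i

namespace IsSaturatedClopen

variable {Z ι : Type*} [TopologicalSpace Z] {Y : ι → Set Z} {H K : Set Z}

theorem univ : IsSaturatedClopen Y Set.univ := ⟨isClopen_univ, fun _ => Or.inl (subset_univ _)⟩

theorem compl (h : IsSaturatedClopen Y H) : IsSaturatedClopen Y Hᶜ :=
  ⟨h.1.compl, fun i => (h.2 i).symm.imp (fun h => h.subset_compl_right)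
    fun h => disjoint_compl_right_iff_subset.2 h⟩

theorem inter (h : IsSaturatedClopen Y H) (k : IsSaturatedClopen Y K) :
    IsSaturatedClopen Y (H ∩ K) := by
  refine ⟨h.1.inter k.1, fun i => ?_⟩
  rcases h.2 i with h1 | h1
  · rcases k.2 i with k1 | k1
    · exact Or.inl (subset_inter h1 k1)
    · exact Or.inr (k1.mono_right inter_subset_right)
  · exact Or.inr (h1.mono_right inter_subset_left)

theorem diff (h : IsSaturatedClopen Y H) (k : IsSaturatedClopen Y K) :
    IsSaturatedClopen Y (H \ K) := h.inter k.compl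

theorem biInter {α : Type*} (t : Finset α) (H : α → Set Z)
    (h : ∀ a ∈ t, IsSaturatedClopen Y (H a)) : IsSaturatedClopen Y (⋂ a ∈ t, H a) := by
  classical
  induction t using Finset.induction_on with
  | empty => simpa using univ
  | insert a s _ ih =>
    rw [Finset.set_biInter_insert]
    exact (h a (Finset.mem_insert_self a s)).inter
      (ih fun b hb => h b (Finset.mem_insert_of_mem hb))

theorem subset_of_mem (h : IsSaturatedClopen Y H) {i : ι} {x : Z} (hx : x ∈ Y i) (hH : x ∈ H) :
    Y i ⊆ H :=
  (h.2 i).resolve_right fun hd => disjoint_left.1 hd hx hH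

end IsSaturatedClopen

variable {Z Z' ι ι' : Type*} [MetricSpace Z] [MetricSpace Z'] [CompactSpace Z] [CompactSpace Z']
  {Y : ι → Set Z} {Y' : ι' → Set Z'}

/-- The points of `N` off `Y i` have saturated clopen neighbourhoods contained in balls of radius
`δ` about points of `Y i`. -/
def IsNear (Y : ι → Set Z) (i : ι) (N : Set Z) (δ : ℝ) : Prop :=
  ∀ x ∈ N, x ∉ Y i → ∃ V, IsSaturatedClopen Y V ∧ x ∈ V ∧ ∃ y ∈ Y i, V ⊆ ball y δ

omit [CompactSpace Z] in
theorem IsNear.mono {i : ι} {N N₁ : Set Z} {δ : ℝ} (h : IsNear Y i N δ) (hN : N₁ ⊆ N) :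
    IsNear Y i N₁ δ := fun x hx => h x (hN hx)

/-- A member through `x` stays inside `U`, so every point of `Uᶜ` is separated from `x` by a
saturated clopen set; by compactness finitely many of these suffice. -/
theorem IsNullFamily.exists_isSaturatedClopen (hY : IsNullFamily Y) {U : Set Z} (hU : IsOpen U)
    {x : Z} (hx : x ∈ U) (h : ∀ i, x ∈ Y i → Y i ⊆ U) :
    ∃ H, IsSaturatedClopen Y H ∧ x ∈ H ∧ H ⊆ U := by
  have key : ∀ z ∈ Uᶜ, ∃ H, IsSaturatedClopen Y H ∧ x ∈ H ∧ z ∉ H := by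
    intro z hz
    by_contra! hcon
    rcases hY.separated x z hcon with rfl | ⟨i, h1, h2⟩
    · exact hz hx
    · exact hz (h i h1 h2)
  choose! H hsat hxH hzH using key
  obtain ⟨t, ht, hcov⟩ := hU.isClosed_compl.isCompact.elim_nhds_subcover (fun z => (H z)ᶜ)
    fun z hz => (hsat z hz).1.compl.isOpen.mem_nhds (hzH z hz)
  refine ⟨⋂ z ∈ t, H z, .biInter t H fun z hz => hsat z (ht z hz), ?_, ?_⟩
  · simp only [mem_iInter]
    exact fun z hz => hxH z (ht z hz)
  · intro w hw
    by_contra hwU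
    obtain ⟨z, hz, hwz⟩ := mem_iUnion₂.1 (hcov hwU)
    exact hwz (mem_iInter₂.1 hw z hz)

omit [CompactSpace Z] in
theorem IsNullFamily.isOpen_diff (hY : IsNullFamily Y) {U : Set Z} (hU : IsOpen U) (i : ι) {ε : ℝ}
    (hε : 0 < ε) : IsOpen (U \ ⋃ j ∈ {j | ε ≤ diam (Y j) ∧ j ≠ i}, Y j) := by
  refine hU.sdiff (Finite.isClosed_biUnion ?_ fun j _ => hY.isClosed j)
  exact (hY.finite_diam ε hε).subset fun j hj => hj.1

theorem subset_ball_of_diam_lt {s : Set Z} {x : Z} (hx : x ∈ s) {r : ℝ} (h : diam s < r) :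
    s ⊆ ball x r := fun _ hz =>
  (dist_le_diam_of_mem isBounded_of_compactSpace hz hx).trans_lt h

/-- Only finitely many members have diameter at least `δ / 2`. Once those other than `Y i` are
removed from the `δ / 2`-neighbourhood of `Y i`, a member through a remaining point off `Y i` is
small and fits in a `δ`-ball about a point of `Y i`. -/
theorem IsNullFamily.exists_isNear (hY : IsNullFamily Y) {i : ι} {N : Set Z}
    (hN : IsSaturatedClopen Y N) (hi : Y i ⊆ N) {δ : ℝ} (hδ : 0 < δ) :
    ∃ N₁, IsSaturatedClopen Y N₁ ∧ Y i ⊆ N₁ ∧ N₁ ⊆ N ∧ IsNear Y i N₁ δ := by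
  obtain ⟨x, hx⟩ := hY.nonempty i
  have hU := hY.isOpen_diff (hN.1.isOpen.inter (isOpen_thickening (δ := δ / 2) (E := Y i))) i
    (half_pos hδ)
  set U := (N ∩ thickening (δ / 2) (Y i)) \ ⋃ j ∈ {j | δ / 2 ≤ diam (Y j) ∧ j ≠ i}, Y j with hUdef
  have hYU : Y i ⊆ U := by
    intro y hy
    refine ⟨⟨hi hy, self_subset_thickening (half_pos hδ) _ hy⟩, ?_⟩
    simp only [mem_iUnion, not_exists]
    rintro j ⟨-, hj⟩ hyj
    exact hj (hY.eq_of_mem j i y hyj hy)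
  obtain ⟨H, hH, hxH, hHU⟩ := hY.exists_isSaturatedClopen hU (hYU hx)
    fun j hj => hY.eq_of_mem i j x hx hj ▸ hYU
  refine ⟨H, hH, hH.subset_of_mem hx hxH, fun z hz => (hHU hz).1.1, fun z hz hzi => ?_⟩
  obtain ⟨y, hy, hzy⟩ := mem_thickening_iff.1 (hHU hz).1.2
  obtain ⟨V, hV, hzV, hVU⟩ := hY.exists_isSaturatedClopen (isOpen_ball (x := y) (ε := δ))
    (show z ∈ ball y δ from hzy.trans (half_lt_self hδ)) (by
      intro j hj
      have hjd : diam (Y j) < δ / 2 := by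
        by_contra! hd
        refine (hHU hz).2 (mem_biUnion (x := j) ⟨hd, ?_⟩ hj)
        rintro rfl
        exact hzi hj
      refine (subset_ball_of_diam_lt hj hjd).trans (ball_subset_ball' ?_)
      linarith)
  exact ⟨V, hV, hzV, y, hy, hVU⟩

/-- As `Y i` has empty interior, there are points off `Y i` arbitrarily close to `y` that also avoid
the other large members. The resulting `Q` serves as partner for a piece cut off on the opposite
side. -/
theorem IsNullFamily.exists_subset_of_mem (hY : IsNullFamily Y) {i : ι} {U : Set Z}
    (hU : IsOpen U) {y : Z} (hy : y ∈ U) (hyi : y ∈ Y i) :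
    ∃ Q, IsSaturatedClopen Y Q ∧ Q.Nonempty ∧ Q ⊆ U ∧ Disjoint (Y i) Q := by
  obtain ⟨r, hr, hrU⟩ := Metric.isOpen_iff.1 hU y hy
  have hV := hY.isOpen_diff (isOpen_ball (x := y) (ε := r / 2)) i (half_pos hr)
  set V := ball y (r / 2) \ ⋃ j ∈ {j | r / 2 ≤ diam (Y j) ∧ j ≠ i}, Y j with hVdef
  have hyV : y ∈ V := by
    refine ⟨mem_ball_self (half_pos hr), ?_⟩
    simp only [mem_iUnion, not_exists]
    rintro j ⟨-, hj⟩ hyj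
    exact hj (hY.eq_of_mem j i y hyj hyi)
  have hnot : ¬ V ⊆ Y i := fun hVi => by
    have := interior_maximal hVi hV hyV
    rw [hY.interior_eq_empty] at this
    exact this
  obtain ⟨x, hxV, hxi⟩ := not_subset.1 hnot
  obtain ⟨Q, hQ, hxQ, hQU⟩ := hY.exists_isSaturatedClopen
    ((isOpen_ball (x := y) (ε := r)).sdiff (hY.isClosed i)) (x := x)
    ⟨ball_subset_ball (half_le_self hr.le) hxV.1, hxi⟩ (by
      intro j hj
      have hji : j ≠ i := by rintro rfl; exact hxi hj
      have hjd : diam (Y j) < r / 2 := by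
        by_contra! hd
        exact hxV.2 (mem_biUnion (x := j) ⟨hd, hji⟩ hj)
      intro z hz
      refine ⟨?_, fun hzi => hji (hY.eq_of_mem j i z hz hzi)⟩
      have h1 := subset_ball_of_diam_lt hj hjd hz
      have h2 := hxV.1
      rw [mem_ball] at h1 h2 ⊢
      linarith [dist_triangle z x y])
  exact ⟨Q, hQ, ⟨x, hxQ⟩, fun z hz => hrU (hQU hz).1, disjoint_right.2 fun z hz => (hQU hz).2⟩

/-- The points of `N × N'` which are `δ`-close to the graph of `φ`. -/
def coreRel {i : ι} {i' : ι'} (φ : Y i ≃ₜ Y' i') (N : Set Z) (N' : Set Z') (δ : ℝ) :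
    Set (Z × Z') :=
  {q | q.1 ∈ N ∧ q.2 ∈ N' ∧ ∃ y : Y i, dist q.1 y ≤ δ ∧ dist q.2 (φ y) ≤ δ}

/-- Relations between `N` and `N'` which approximate homeomorphisms matching the families. -/
inductive IsApprox (Y : ι → Set Z) (Y' : ι' → Set Z') : Set Z → Set Z' → Set (Z × Z') → Prop
  | core {i : ι} {i' : ι'} (φ : Y i ≃ₜ Y' i') {N : Set Z} {N' : Set Z'} {δ : ℝ}
      (hN : IsSaturatedClopen Y N) (hN' : IsSaturatedClopen Y' N') (hi : Y i ⊆ N) (hi' : Y' i' ⊆ N')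
      (hδ : 0 < δ) (hn : IsNear Y i N δ) (hn' : IsNear Y' i' N' δ) :
      IsApprox Y Y' N N' (coreRel φ N N' δ)
  | union {N₁ N₂ : Set Z} {N₁' N₂' : Set Z'} {R₁ R₂ : Set (Z × Z')} (h₁ : IsApprox Y Y' N₁ N₁' R₁)
      (h₂ : IsApprox Y Y' N₂ N₂' R₂) (hd : Disjoint N₁ N₂) (hd' : Disjoint N₁' N₂') :
      IsApprox Y Y' (N₁ ∪ N₂) (N₁' ∪ N₂') (R₁ ∪ R₂)

/-- The fibres of both projections of the relation `R` have diameter at most `ε`. -/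
def IsFine (ε : ℝ) (R : Set (Z × Z')) : Prop :=
  (∀ z z₁ z₂, (z, z₁) ∈ R → (z, z₂) ∈ R → dist z₁ z₂ ≤ ε) ∧
    ∀ z z₁ z₂, (z₁, z) ∈ R → (z₂, z) ∈ R → dist z₁ z₂ ≤ ε

/-- `R` contains an `ε`-fine approximation. -/
def IsRefinable (Y : ι → Set Z) (Y' : ι' → Set Z') (ε : ℝ) (N : Set Z) (N' : Set Z')
    (R : Set (Z × Z')) : Prop :=
  ∃ R₁, R₁ ⊆ R ∧ IsApprox Y Y' N N' R₁ ∧ IsFine ε R₁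

omit [CompactSpace Z] [CompactSpace Z'] in
-- Symmetry of cores: it allows refinements to be carried out on the left side only.
theorem swap_preimage_coreRel {i : ι} {i' : ι'} (φ : Y i ≃ₜ Y' i') (N : Set Z) (N' : Set Z')
    (δ : ℝ) : Prod.swap ⁻¹' coreRel φ N N' δ = coreRel φ.symm N' N δ := by
  ext ⟨z', z⟩
  constructor
  · rintro ⟨h1, h2, y, h3, h4⟩
    exact ⟨h2, h1, φ y, h4, by simpa using h3⟩
  · rintro ⟨h1, h2, y, h3, h4⟩
    exact ⟨h2, h1, φ.symm y, h4, by simpa using h3⟩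

namespace IsApprox

omit [CompactSpace Z] [CompactSpace Z'] in
theorem swap {N : Set Z} {N' : Set Z'} {R : Set (Z × Z')} (h : IsApprox Y Y' N N' R) :
    IsApprox Y' Y N' N (Prod.swap ⁻¹' R) := by
  induction h with
  | core φ hN hN' hi hi' hδ hn hn' =>
    rw [swap_preimage_coreRel]
    exact .core φ.symm hN' hN hi' hi hδ hn' hn
  | union _ _ hd hd' ih₁ ih₂ =>
    rw [preimage_union]
    exact .union ih₁ ih₂ hd' hd

omit [CompactSpace Z] [CompactSpace Z'] in
theorem subset_prod {N : Set Z} {N' : Set Z'} {R : Set (Z × Z')} (h : IsApprox Y Y' N N' R) :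
    R ⊆ N ×ˢ N' := by
  induction h with
  | core φ => exact fun q hq => ⟨hq.1, hq.2.1⟩
  | union _ _ _ _ ih₁ ih₂ =>
    exact union_subset (ih₁.trans (prod_mono subset_union_left subset_union_left))
      (ih₂.trans (prod_mono subset_union_right subset_union_right))

omit [CompactSpace Z] [CompactSpace Z'] in
-- Nearness gives totality: a point off `Y i` is `δ`-close to some `y` and hence related to `φ y`.
theorem exists_mem {N : Set Z} {N' : Set Z'} {R : Set (Z × Z')} (h : IsApprox Y Y' N N' R)
    {z : Z} (hz : z ∈ N) : ∃ z', (z, z') ∈ R := by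
  induction h with
  | @core i i' φ N N' δ _ _ _ hi' hδ hn _ =>
    by_cases hzi : z ∈ Y i
    · exact ⟨φ ⟨z, hzi⟩, hz, hi' (φ _).2, ⟨z, hzi⟩, by simpa using hδ.le, by simpa using hδ.le⟩
    · obtain ⟨V, _, hzV, y, hy, hV⟩ := hn z hz hzi
      exact ⟨φ ⟨y, hy⟩, hz, hi' (φ _).2, ⟨y, hy⟩, (hV hzV).le, by simpa using hδ.le⟩
  | union _ _ _ _ ih₁ ih₂ =>
    rcases hz with hz | hz
    · exact (ih₁ hz).imp fun _ => Or.inl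
    · exact (ih₂ hz).imp fun _ => Or.inr

theorem isClosed (hY : IsNullFamily Y) {N : Set Z} {N' : Set Z'} {R : Set (Z × Z')}
    (h : IsApprox Y Y' N N' R) : IsClosed R := by
  induction h with
  | @core i i' φ N N' δ hN hN' =>
    have : CompactSpace (Y i) := isCompact_iff_compactSpace.1 (hY.isClosed i).isCompact
    -- The core is the projection of this compact set of triples `(z, z', y)`.
    have hc : IsClosed {p : (Z × Z') × Y i | p.1.1 ∈ N ∧ p.1.2 ∈ N' ∧ dist p.1.1 p.2 ≤ δ ∧
        dist p.1.2 (φ p.2) ≤ δ} := by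
      refine (hN.1.isClosed.preimage (continuous_fst.comp continuous_fst)).inter
        ((hN'.1.isClosed.preimage (continuous_snd.comp continuous_fst)).inter
          (IsClosed.inter ?_ ?_))
      · exact isClosed_le ((continuous_fst.comp continuous_fst).dist
          (continuous_subtype_val.comp continuous_snd)) continuous_const
      · exact isClosed_le ((continuous_snd.comp continuous_fst).dist
          (continuous_subtype_val.comp (φ.continuous.comp continuous_snd))) continuous_const
    have := (hc.isCompact.image continuous_fst).isClosed
    convert this using 1
    ext q
    simp only [coreRel, mem_ofPred_eq, mem_image, Prod.exists, exists_and_right, exists_eq_right]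
    grind
  | union _ _ _ _ ih₁ ih₂ => exact ih₁.union ih₂

end IsApprox

omit [CompactSpace Z] [CompactSpace Z'] in
theorem IsFine.union {ε : ℝ} {N₁ N₂ : Set Z} {N₁' N₂' : Set Z'} {R₁ R₂ : Set (Z × Z')}
    (h₁ : IsFine ε R₁) (h₂ : IsFine ε R₂) (hR₁ : R₁ ⊆ N₁ ×ˢ N₁') (hR₂ : R₂ ⊆ N₂ ×ˢ N₂')
    (hd : Disjoint N₁ N₂) (hd' : Disjoint N₁' N₂') : IsFine ε (R₁ ∪ R₂) := by
  rw [disjoint_left] at hd hd'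
  constructor
  · rintro z z₁ z₂ (h | h) (k | k)
    · exact h₁.1 z _ _ h k
    · exact absurd (hR₂ k).1 (hd (hR₁ h).1)
    · exact absurd (hR₂ h).1 (hd (hR₁ k).1)
    · exact h₂.1 z _ _ h k
  · rintro z z₁ z₂ (h | h) (k | k)
    · exact h₁.2 z _ _ h k
    · exact absurd (hR₂ k).2 (hd' (hR₁ h).2)
    · exact absurd (hR₂ h).2 (hd' (hR₁ k).2)
    · exact h₂.2 z _ _ h k

namespace IsRefinable

omit [CompactSpace Z] [CompactSpace Z'] in
theorem swap {ε : ℝ} {N : Set Z} {N' : Set Z'} {R : Set (Z × Z')}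
    (h : IsRefinable Y Y' ε N N' R) : IsRefinable Y' Y ε N' N (Prod.swap ⁻¹' R) := by
  obtain ⟨R₁, h1, h2, h3⟩ := h
  exact ⟨Prod.swap ⁻¹' R₁, preimage_mono h1, h2.swap, h3.2, h3.1⟩

omit [CompactSpace Z] [CompactSpace Z'] in
theorem swap_core {ε δ : ℝ} {i : ι} {i' : ι'} {φ : Y i ≃ₜ Y' i'} {N : Set Z} {N' : Set Z'}
    (h : IsRefinable Y Y' ε N N' (coreRel φ N N' δ)) :
    IsRefinable Y' Y ε N' N (coreRel φ.symm N' N δ) := by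
  rw [← swap_preimage_coreRel]
  exact h.swap

omit [CompactSpace Z] [CompactSpace Z'] in
theorem mono {ε : ℝ} {N : Set Z} {N' : Set Z'} {R R₂ : Set (Z × Z')}
    (h : IsRefinable Y Y' ε N N' R) (hR : R ⊆ R₂) : IsRefinable Y Y' ε N N' R₂ := by
  obtain ⟨R₁, h1, h2⟩ := h
  exact ⟨R₁, h1.trans hR, h2⟩

omit [CompactSpace Z] [CompactSpace Z'] in
theorem union {ε : ℝ} {N₁ N₂ : Set Z} {N₁' N₂' : Set Z'} {R₁ R₂ : Set (Z × Z')}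
    (h₁ : IsRefinable Y Y' ε N₁ N₁' R₁) (h₂ : IsRefinable Y Y' ε N₂ N₂' R₂) (hd : Disjoint N₁ N₂)
    (hd' : Disjoint N₁' N₂') : IsRefinable Y Y' ε (N₁ ∪ N₂) (N₁' ∪ N₂') (R₁ ∪ R₂) := by
  obtain ⟨S₁, a1, b1, c1⟩ := h₁
  obtain ⟨S₂, a2, b2, c2⟩ := h₂
  exact ⟨S₁ ∪ S₂, union_subset_union a1 a2, b1.union b2 hd hd',
    c1.union c2 b1.subset_prod b2.subset_prod hd hd'⟩

omit [CompactSpace Z] [CompactSpace Z'] in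
/-- Splitting off a pair of sets close to `y` and to `φ y`. -/
theorem of_diff {ε δ : ℝ} {i : ι} {i' : ι'} {φ : Y i ≃ₜ Y' i'} {N V : Set Z} {N' V' : Set Z'}
    (h : IsRefinable Y Y' ε (N \ V) (N' \ V') (coreRel φ (N \ V) (N' \ V') δ))
    (hV : IsRefinable Y Y' ε V V' (V ×ˢ V')) (hVN : V ⊆ N) (hVN' : V' ⊆ N') (y : Y i)
    (hVy : V ⊆ ball (y : Z) δ) (hVy' : V' ⊆ ball (φ y : Z') δ) :
    IsRefinable Y Y' ε N N' (coreRel φ N N' δ) := by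
  have := (h.union hV disjoint_sdiff_left disjoint_sdiff_left).mono
    (R₂ := coreRel φ N N' δ) (by
      rintro ⟨z, z'⟩ (⟨h1, h2, h3⟩ | ⟨h1, h2⟩)
      · exact ⟨h1.1, h2.1, h3⟩
      · exact ⟨hVN h1, hVN' h2, y, (hVy h1).le, (hVy' h2).le⟩)
  rwa [sdiff_union_of_subset hVN, sdiff_union_of_subset hVN'] at this

omit [CompactSpace Z] in
/-- Splitting off a finite family of sets on the left, matched with small sets on the right. -/
theorem of_list (hY' : IsNullFamily Y') {ε δ : ℝ} (hε : 0 < ε) (hδ : 0 < δ)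
    {i : ι} {i' : ι'} (φ : Y i ≃ₜ Y' i') (t : List (Set Z)) {N : Set Z} {N' : Set Z'}
    (hN : IsSaturatedClopen Y N) (hN' : IsSaturatedClopen Y' N') (hi : Y i ⊆ N) (hi' : Y' i' ⊆ N')
    (ht : ∀ V ∈ t, IsSaturatedClopen Y V ∧ Disjoint (Y i) V ∧ (∃ y : Y i, V ⊆ ball (y : Z) δ) ∧
      ∀ W, IsSaturatedClopen Y W → W.Nonempty → W ⊆ N ∩ V → ∀ Q y, IsSaturatedClopen Y' Q →
        Q.Nonempty → Q ⊆ ball y ε → IsRefinable Y Y' (6 * ε) W Q (W ×ˢ Q))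
    (h : ∀ N₁ N₁', IsSaturatedClopen Y N₁ → IsSaturatedClopen Y' N₁' → Y i ⊆ N₁ → Y' i' ⊆ N₁' →
      N₁ ⊆ N → N₁' ⊆ N' → (∀ V ∈ t, Disjoint N₁ V) →
      IsRefinable Y Y' (6 * ε) N₁ N₁' (coreRel φ N₁ N₁' δ)) :
    IsRefinable Y Y' (6 * ε) N N' (coreRel φ N N' δ) := by
  induction t generalizing N N' with
  | nil => exact h N N' hN hN' hi hi' subset_rfl subset_rfl (by simp)
  | cons V t ih =>
    obtain ⟨⟨hV, hVi, ⟨y, hVy⟩, hVW⟩, ht⟩ := List.forall_mem_cons.1 ht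
    by_cases hne : (N ∩ V).Nonempty
    -- Radius `ε` makes `Q` small enough for `hVW`; radius `δ` keeps `(N ∩ V) ×ˢ Q` inside the core
    -- relation.
    · obtain ⟨Q, hQ, hQne, hQU, hQi⟩ := hY'.exists_subset_of_mem (i := i')
        ((isOpen_ball (x := (φ y : Z')) (ε := min ε δ)).inter hN'.1.isOpen)
        ⟨mem_ball_self (lt_min hε hδ), hi' (φ y).2⟩ (φ y).2
      have hQb : Q ⊆ ball (φ y : Z') (min ε δ) := fun z hz => (hQU hz).1
      refine of_diff (V := N ∩ V) (V' := Q) ?_ (hVW (N ∩ V) (hN.inter hV) hne subset_rfl Q (φ y)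
        hQ hQne (hQb.trans (ball_subset_ball (min_le_left _ _)))) inter_subset_left
        (fun z hz => (hQU hz).2) y (inter_subset_right.trans hVy)
        (hQb.trans (ball_subset_ball (min_le_right _ _)))
      refine ih (hN.diff (hN.inter hV)) (hN'.diff hQ)
        (fun z hz => ⟨hi hz, fun hzV => disjoint_left.1 hVi hz hzV.2⟩)
        (fun z hz => ⟨hi' hz, fun hzQ => disjoint_left.1 hQi hz hzQ⟩) ?_ ?_
      · intro V' hV'
        obtain ⟨h1, h2, h3, h4⟩ := ht V' hV'
        exact ⟨h1, h2, h3, fun W hW hWne hWV => h4 W hW hWne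
          (hWV.trans (inter_subset_inter_left _ sdiff_subset))⟩
      · intro N₁ N₁' a1 a2 a3 a4 a5 a6 a7
        refine h N₁ N₁' a1 a2 a3 a4 (a5.trans sdiff_subset) (a6.trans sdiff_subset)
          (List.forall_mem_cons.2 ⟨?_, a7⟩)
        exact disjoint_left.2 fun z hz hzV => (a5 hz).2 ⟨(a5 hz).1, hzV⟩
    · refine ih hN hN' hi hi' ht fun N₁ N₁' a1 a2 a3 a4 a5 a6 a7 =>
        h N₁ N₁' a1 a2 a3 a4 a5 a6 (List.forall_mem_cons.2 ⟨?_, a7⟩)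
      exact disjoint_left.2 fun z hz hzV => hne ⟨z, a5 hz, hzV⟩

end IsRefinable

/-- Every point of `N` off `Y i` has a saturated clopen neighbourhood whose saturated clopen subsets
in `N` off `Y i` can be finely matched with all small sets. -/
def IsLocallyRefinable (Y : ι → Set Z) (Y' : ι' → Set Z') (ε : ℝ) (i : ι) (N : Set Z) : Prop :=
  ∀ x ∈ N, x ∉ Y i → ∃ V, IsSaturatedClopen Y V ∧ x ∈ V ∧
    ∀ W, IsSaturatedClopen Y W → W.Nonempty → W ⊆ N ∩ V → Disjoint (Y i) W →
      ∀ Q y, IsSaturatedClopen Y' Q → Q.Nonempty → Q ⊆ ball y ε →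
        IsRefinable Y Y' (6 * ε) W Q (W ×ˢ Q)

omit [CompactSpace Z] [CompactSpace Z'] in
theorem IsLocallyRefinable.mono {ε : ℝ} {i : ι} {N N₁ : Set Z}
    (h : IsLocallyRefinable Y Y' ε i N) (hN : N₁ ⊆ N) : IsLocallyRefinable Y Y' ε i N₁ :=
  fun x hx hxi => by
    obtain ⟨V, hV, hxV, hW⟩ := h x (hN hx) hxi
    exact ⟨V, hV, hxV, fun W a b c => hW W a b (c.trans (inter_subset_inter_left _ hN))⟩

/-- Shrinking the left part of a core. -/
theorem IsRefinable.of_shrink (hY : IsNullFamily Y) (hY' : IsNullFamily Y') {ε δ δ₁ : ℝ}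
    (hε : 0 < ε) (hδ : 0 < δ) (hδ₁ : 0 < δ₁)
    {i : ι} {i' : ι'} (φ : Y i ≃ₜ Y' i') {N : Set Z} {N' : Set Z'}
    (hN : IsSaturatedClopen Y N) (hN' : IsSaturatedClopen Y' N') (hi : Y i ⊆ N) (hi' : Y' i' ⊆ N')
    (hn : IsNear Y i N δ) (hl : IsLocallyRefinable Y Y' ε i N)
    (h : ∀ N₁ N₁', IsSaturatedClopen Y N₁ → IsSaturatedClopen Y' N₁' → Y i ⊆ N₁ → Y' i' ⊆ N₁' →
      N₁ ⊆ N → N₁' ⊆ N' → IsNear Y i N₁ δ₁ →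
      IsRefinable Y Y' (6 * ε) N₁ N₁' (coreRel φ N₁ N₁' δ)) :
    IsRefinable Y Y' (6 * ε) N N' (coreRel φ N N' δ) := by
  obtain ⟨N₀, hN₀, hiN₀, hN₀N, hnear⟩ := hY.exists_isNear hN hi hδ₁
  have key : ∀ x ∈ N \ N₀, ∃ V, IsSaturatedClopen Y V ∧ x ∈ V ∧ Disjoint (Y i) V ∧
      (∃ y : Y i, V ⊆ ball (y : Z) δ) ∧
      ∀ W, IsSaturatedClopen Y W → W.Nonempty → W ⊆ N ∩ V → ∀ Q y, IsSaturatedClopen Y' Q →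
        Q.Nonempty → Q ⊆ ball y ε → IsRefinable Y Y' (6 * ε) W Q (W ×ˢ Q) := by
    intro x hx
    have hxi : x ∉ Y i := fun hxi => hx.2 (hiN₀ hxi)
    obtain ⟨V₁, hV₁, hxV₁, y, hy, hVy⟩ := hn x hx.1 hxi
    obtain ⟨V₂, hV₂, hxV₂, hW⟩ := hl x hx.1 hxi
    have hdis : Disjoint (Y i) ((V₁ ∩ V₂) \ N₀) :=
      disjoint_left.2 fun z hz hzV => hzV.2 (hiN₀ hz)
    refine ⟨(V₁ ∩ V₂) \ N₀, (hV₁.inter hV₂).diff hN₀, ⟨⟨hxV₁, hxV₂⟩, hx.2⟩, hdis,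
      ⟨⟨y, hy⟩, fun z hz => hVy hz.1.1⟩, fun W a b c => hW W a b
        (fun z hz => ⟨(c hz).1, (c hz).2.1.2⟩) (hdis.mono_right fun z hz => (c hz).2)⟩
  choose! V hV hxV hVi hVy hVW using key
  -- Finitely many pieces cover `N \ N₀`; after they are cut off, the rest lies in `N₀` and inherits
  -- its nearness.
  obtain ⟨t, ht, hcov⟩ := (hN.diff hN₀).1.isClosed.isCompact.elim_nhds_subcover V
    fun x hx => (hV x hx).1.isOpen.mem_nhds (hxV x hx)
  refine IsRefinable.of_list hY' hε hδ φ (t.toList.map V) hN hN' hi hi' ?_ ?_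
  · intro U hU
    obtain ⟨x, hx, rfl⟩ := List.mem_map.1 hU
    have hx := ht x (Finset.mem_toList.1 hx)
    exact ⟨hV x hx, hVi x hx, hVy x hx, hVW x hx⟩
  · intro N₁ N₁' a1 a2 a3 a4 a5 a6 a7
    refine h N₁ N₁' a1 a2 a3 a4 a5 a6 (hnear.mono fun z hz => ?_)
    by_contra hzN
    obtain ⟨x, hx, hzx⟩ := mem_iUnion₂.1 (hcov ⟨a5 hz, hzN⟩)
    exact disjoint_left.1 (a7 (V x) (List.mem_map_of_mem (Finset.mem_toList.2 hx))) hz hzx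

omit [CompactSpace Z] [CompactSpace Z'] in
-- The triangle inequality through `φ y₁` and `φ y₂` already gives `3 * ε`; the constant `6` is
-- dictated by the balls of radius `3 * ε` in `isRefinable_prod`.
theorem dist_le_of_coreRel {ε δ : ℝ} {i : ι} {i' : ι'} {φ : Y i ≃ₜ Y' i'} {N : Set Z} {N' : Set Z'}
    (hδε : δ ≤ ε) (hφ : ∀ y₁ y₂ : Y i, dist y₁ y₂ ≤ 2 * δ → dist (φ y₁) (φ y₂) ≤ ε) {z : Z}
    {z₁ z₂ : Z'} (h₁ : (z, z₁) ∈ coreRel φ N N' δ) (h₂ : (z, z₂) ∈ coreRel φ N N' δ) :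
    dist z₁ z₂ ≤ 6 * ε := by
  obtain ⟨-, -, y₁, a1, b1⟩ := h₁
  obtain ⟨-, -, y₂, a2, b2⟩ := h₂
  have hy : dist (y₁ : Z) y₂ ≤ 2 * δ := by
    have := dist_triangle_left (y₁ : Z) y₂ z
    simp only at a1 a2
    linarith
  have h1 : dist (φ y₁ : Z') (φ y₂) ≤ ε := hφ y₁ y₂ hy
  have h2 := dist_triangle4_right z₁ z₂ (φ y₁ : Z') (φ y₂)
  have h3 : 0 ≤ dist (φ y₁ : Z') (φ y₂) := dist_nonneg
  simp only at b1 b2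
  linarith

theorem exists_modulus {X X' : Type*} [MetricSpace X] [CompactSpace X] [MetricSpace X']
    (φ : C(X, X')) {ε : ℝ} (hε : 0 < ε) :
    ∃ δ > 0, ∀ y₁ y₂ : X, dist y₁ y₂ ≤ 2 * δ → dist (φ y₁) (φ y₂) ≤ ε := by
  obtain ⟨δ, hδ, h⟩ := Metric.uniformContinuous_iff.1
    (CompactSpace.uniformContinuous_of_continuous φ.continuous) ε hε
  exact ⟨δ / 3, by positivity, fun y₁ y₂ hy => (h (by linarith)).le⟩

/-- The left side is shrunk first and then, after a swap, the right side. The second shrinking only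
removes points on the left, so nearness there survives. What remains is a core whose radius `δ₁` is
below the moduli of continuity of `φ` and `φ.symm`, hence a fine one. -/
theorem IsRefinable.of_isLocallyRefinable (hY : IsNullFamily Y) (hY' : IsNullFamily Y') {ε δ : ℝ}
    (hε : 0 < ε) (hδ : 0 < δ) {i : ι} {i' : ι'} (φ : Y i ≃ₜ Y' i') {N : Set Z} {N' : Set Z'}
    (hN : IsSaturatedClopen Y N) (hN' : IsSaturatedClopen Y' N') (hi : Y i ⊆ N) (hi' : Y' i' ⊆ N')
    (hn : IsNear Y i N δ) (hn' : IsNear Y' i' N' δ) (hl : IsLocallyRefinable Y Y' ε i N)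
    (hl' : IsLocallyRefinable Y' Y ε i' N') :
    IsRefinable Y Y' (6 * ε) N N' (coreRel φ N N' δ) := by
  have : CompactSpace (Y i) := isCompact_iff_compactSpace.1 (hY.isClosed i).isCompact
  have : CompactSpace (Y' i') := isCompact_iff_compactSpace.1 (hY'.isClosed i').isCompact
  obtain ⟨d₁, hd₁, h1⟩ := exists_modulus (φ : C(Y i, Y' i')) hε
  obtain ⟨d₂, hd₂, h2⟩ := exists_modulus (φ.symm : C(Y' i', Y i)) hε
  obtain ⟨δ₁, hδ₁, k1, k2, k3, k4⟩ : ∃ δ₁ > 0, δ₁ ≤ δ ∧ δ₁ ≤ ε ∧ δ₁ ≤ d₁ ∧ δ₁ ≤ d₂ :=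
    ⟨min (min δ ε) (min d₁ d₂), lt_min (lt_min hδ hε) (lt_min hd₁ hd₂),
      (min_le_left _ _).trans (min_le_left _ _), (min_le_left _ _).trans (min_le_right _ _),
      (min_le_right _ _).trans (min_le_left _ _), (min_le_right _ _).trans (min_le_right _ _)⟩
  refine .of_shrink hY hY' hε hδ hδ₁ φ hN hN' hi hi' hn hl fun N₁ N₁' a1 a2 a3 a4 a5 a6 a7 => ?_
  refine IsRefinable.swap_core (φ := φ.symm) ?_
  refine .of_shrink hY' hY hε hδ hδ₁ φ.symm a2 a1 a4 a3 (hn'.mono a6) (hl'.mono a6)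
    fun N₂' N₂ b1 b2 b3 b4 b5 b6 b7 => ?_
  refine IsRefinable.swap_core ?_
  refine ⟨coreRel φ N₂ N₂' δ₁, ?_, .core φ b2 b1 b4 b3 hδ₁ (a7.mono b6) b7, ?_, ?_⟩
  · rintro q ⟨c1, c2, y, c3, c4⟩
    exact ⟨c1, c2, y, c3.trans k1, c4.trans k1⟩
  · exact fun z z₁ z₂ c1 c2 => dist_le_of_coreRel k2 (fun y₁ y₂ hy => h1 y₁ y₂ (by linarith)) c1 c2
  · intro z z₁ z₂ c1 c2
    have hs := swap_preimage_coreRel φ N₂ N₂' δ₁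
    have c1 : (z, z₁) ∈ coreRel φ.symm N₂' N₂ δ₁ := hs ▸ c1
    have c2 : (z, z₂) ∈ coreRel φ.symm N₂' N₂ δ₁ := hs ▸ c2
    exact dist_le_of_coreRel k2 (fun y₁ y₂ hy => h2 y₁ y₂ (by linarith)) c1 c2

/-- Every open set meets a member of `Y'` homeomorphic to any given member of `Y`. -/
def HasDenseCopies (Y : ι → Set Z) (Y' : ι' → Set Z') : Prop :=
  ∀ i (U : Set Z'), IsOpen U → U.Nonempty → ∃ i', (Y' i' ∩ U).Nonempty ∧ Nonempty (Y i ≃ₜ Y' i')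

omit [CompactSpace Z] [CompactSpace Z'] in
theorem HasDenseCopies.exists_subset (h : HasDenseCopies Y Y') (i : ι) {V : Set Z'}
    (hV : IsSaturatedClopen Y' V) (hne : V.Nonempty) :
    ∃ i', Y' i' ⊆ V ∧ Nonempty (Y i ≃ₜ Y' i') := by
  obtain ⟨i', ⟨x, hx, hxV⟩, hφ⟩ := h i V hV.1.isOpen hne
  exact ⟨i', hV.subset_of_mem hx hxV, hφ⟩

/-- A radius exceeding both diameters makes the nearness conditions automatic. -/
theorem IsRefinable.of_homeomorph (hY : IsNullFamily Y) (hY' : IsNullFamily Y') {ε : ℝ}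
    (hε : 0 < ε) {i : ι} {i' : ι'} (φ : Y i ≃ₜ Y' i') {N : Set Z} {N' : Set Z'}
    (hN : IsSaturatedClopen Y N) (hN' : IsSaturatedClopen Y' N') (hi : Y i ⊆ N) (hi' : Y' i' ⊆ N')
    (hl : IsLocallyRefinable Y Y' ε i N) (hl' : IsLocallyRefinable Y' Y ε i' N') :
    IsRefinable Y Y' (6 * ε) N N' (N ×ˢ N') := by
  obtain ⟨x, hx⟩ := hY.nonempty i
  obtain ⟨x', hx'⟩ := hY'.nonempty i'
  have hδ : 0 < diam (univ : Set Z) + diam (univ : Set Z') + 1 := by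
    have := diam_nonneg (s := (univ : Set Z))
    have := diam_nonneg (s := (univ : Set Z'))
    linarith
  refine (IsRefinable.of_isLocallyRefinable hY hY' hε hδ φ hN hN' hi hi' ?_ ?_ hl hl').mono
    fun q hq => ⟨hq.1, hq.2.1⟩
  · refine fun z hz _ => ⟨N, hN, hz, x, hx, (subset_univ N).trans
      (subset_ball_of_diam_lt (mem_univ x) ?_)⟩
    linarith [diam_nonneg (s := (univ : Set Z'))]
  · refine fun z hz _ => ⟨N', hN', hz, x', hx', (subset_univ N').trans
      (subset_ball_of_diam_lt (mem_univ x') ?_)⟩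
    linarith [diam_nonneg (s := (univ : Set Z))]

/-- The number of members of `Y` inside `V` of diameter at least `r`. -/
noncomputable def numLarge (Y : ι → Set Z) (r : ℝ) (V : Set Z) : ℕ :=
  {i | r ≤ diam (Y i) ∧ Y i ⊆ V}.ncard

omit [CompactSpace Z] in
theorem IsNullFamily.numLarge_mono (hY : IsNullFamily Y) {r : ℝ} (hr : 0 < r) {V W : Set Z}
    (h : W ⊆ V) : numLarge Y r W ≤ numLarge Y r V :=
  ncard_le_ncard (fun _ hi => ⟨hi.1, hi.2.trans h⟩)
    ((hY.finite_diam r hr).subset fun _ hi => hi.1)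

omit [CompactSpace Z] in
theorem IsNullFamily.numLarge_lt (hY : IsNullFamily Y) {r : ℝ} (hr : 0 < r) {V W : Set Z}
    (h : W ⊆ V) {i : ι} (hi : r ≤ diam (Y i)) (hiV : Y i ⊆ V) (hiW : Disjoint (Y i) W) :
    numLarge Y r W < numLarge Y r V := by
  refine ncard_lt_ncard ⟨fun _ hi => ⟨hi.1, hi.2.trans h⟩, fun hcon => ?_⟩
    ((hY.finite_diam r hr).subset fun _ hi => hi.1)
  obtain ⟨x, hx⟩ := hY.nonempty i
  exact disjoint_left.1 hiW hx ((hcon (show i ∈ _ from ⟨hi, hiV⟩)).2 hx)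

theorem numLarge_eq_zero {r : ℝ} {V : Set Z} (h : diam V < r) : numLarge Y r V = 0 := by
  rw [numLarge]
  convert ncard_empty ι
  refine eq_empty_of_forall_notMem fun i hi => ?_
  exact absurd (hi.1.trans (diam_mono hi.2 isBounded_of_compactSpace)) (not_le.2 h)

omit [CompactSpace Z] in
theorem diam_lt_of_subset_ball {ε : ℝ} (hε : 0 < ε) {V : Set Z} {x : Z} (h : V ⊆ ball x ε) :
    diam V < 3 * ε :=
  (diam_mono h isBounded_ball).trans_lt ((diam_ball hε.le).trans_lt (by linarith))

/-- Between small sets every core is fine. The index `i₀` only supplies some member: it has a copy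
in `N'`, which in turn has a copy in `N`. -/
theorem IsRefinable.of_diam_le (hY : IsNullFamily Y) (hYY' : HasDenseCopies Y Y')
    (hY'Y : HasDenseCopies Y' Y) {ε : ℝ} {N : Set Z} {N' : Set Z'}
    (hN : IsSaturatedClopen Y N) (hN' : IsSaturatedClopen Y' N') (hne : N.Nonempty)
    (hne' : N'.Nonempty) (i₀ : ι) (hd : diam N ≤ ε) (hd' : diam N' ≤ ε) :
    IsRefinable Y Y' ε N N' (N ×ˢ N') := by
  obtain ⟨i', hi', -⟩ := hYY'.exists_subset i₀ hN' hne'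
  obtain ⟨i, hi, ⟨φ⟩⟩ := hY'Y.exists_subset i' hN hne
  obtain ⟨x, hx⟩ := hY.nonempty i
  have hδ : 0 < diam N + diam N' + 1 := by
    have := diam_nonneg (s := N)
    have := diam_nonneg (s := N')
    linarith
  refine ⟨coreRel φ.symm N N' (diam N + diam N' + 1), fun q hq => ⟨hq.1, hq.2.1⟩,
    .core φ.symm hN hN' hi hi' hδ ?_ ?_, ?_, ?_⟩
  · refine fun z hz _ => ⟨N, hN, hz, x, hx, subset_ball_of_diam_lt (hi hx) ?_⟩
    linarith [diam_nonneg (s := N')]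
  · refine fun z hz _ => ⟨N', hN', hz, φ.symm ⟨x, hx⟩, (φ.symm ⟨x, hx⟩).2,
      subset_ball_of_diam_lt (hi' (φ.symm ⟨x, hx⟩).2) ?_⟩
    linarith [diam_nonneg (s := N)]
  · exact fun z z₁ z₂ h1 h2 =>
      (dist_le_diam_of_mem isBounded_of_compactSpace h1.2.1 h2.2.1).trans hd'
  · exact fun z z₁ z₂ h1 h2 => (dist_le_diam_of_mem isBounded_of_compactSpace h1.1 h2.1).trans hd

/-- Induction on the number of members of diameter at least `3 * ε` in `N` and `N'`. If there is
one, it is matched with a copy on the other side. Pieces cut off beside it no longer contain it, and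
their partners lie in `ε`-balls, too small to contain any large member, so the count drops for
pieces of either side. If there is none, every point has a saturated clopen neighbourhood in a ball
of radius `3 * ε`; the pieces have diameter at most `6 * ε`, and `of_diam_le` applies. -/
theorem isRefinable_prod (hY : IsNullFamily Y) (hY' : IsNullFamily Y') (hYY' : HasDenseCopies Y Y')
    (hY'Y : HasDenseCopies Y' Y) (i₀ : ι) {ε : ℝ} (hε : 0 < ε) {N : Set Z} {N' : Set Z'}
    (hN : IsSaturatedClopen Y N) (hN' : IsSaturatedClopen Y' N') (hne : N.Nonempty)
    (hne' : N'.Nonempty) : IsRefinable Y Y' (6 * ε) N N' (N ×ˢ N') := by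
  obtain ⟨m, hm⟩ : ∃ m, numLarge Y (3 * ε) N + numLarge Y' (3 * ε) N' = m := ⟨_, rfl⟩
  have hε3 : 0 < 3 * ε := by positivity
  induction m using Nat.strong_induction_on generalizing N N' with
  | h m ih =>
  have hleft : ∀ W Q y, IsSaturatedClopen Y W → W.Nonempty → numLarge Y (3 * ε) W < m →
      IsSaturatedClopen Y' Q → Q.Nonempty → Q ⊆ ball y ε →
        IsRefinable Y Y' (6 * ε) W Q (W ×ˢ Q) := by
    intro W Q y hW hWne hWm hQ hQne hQy
    refine ih _ ?_ hW hQ hWne hQne rfl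
    rwa [numLarge_eq_zero (diam_lt_of_subset_ball hε hQy), add_zero]
  have hright : ∀ W Q y, IsSaturatedClopen Y' W → W.Nonempty → numLarge Y' (3 * ε) W < m →
      IsSaturatedClopen Y Q → Q.Nonempty → Q ⊆ ball y ε →
        IsRefinable Y' Y (6 * ε) W Q (W ×ˢ Q) := by
    intro W Q y hW hWne hWm hQ hQne hQy
    have := (ih _ ?_ hQ hW hQne hWne rfl).swap
    · rwa [preimage_swap_prod] at this
    · rwa [numLarge_eq_zero (diam_lt_of_subset_ball hε hQy), zero_add]
  by_cases hbig : ∃ i, 3 * ε ≤ diam (Y i) ∧ Y i ⊆ N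
  · obtain ⟨i, hid, hiN⟩ := hbig
    obtain ⟨i', hi', ⟨φ⟩⟩ := hYY'.exists_subset i hN' hne'
    have hlt : 0 < numLarge Y (3 * ε) N :=
      (ncard_pos ((hY.finite_diam _ hε3).subset fun _ hi => hi.1)).2 ⟨i, hid, hiN⟩
    refine .of_homeomorph hY hY' hε φ hN hN' hiN hi' ?_ ?_
    · refine fun x hx _ => ⟨N, hN, hx, fun W hW hWne hWN hWi Q y => hleft W Q y hW hWne ?_⟩
      have := hY.numLarge_lt hε3 (hWN.trans inter_subset_left) hid hiN hWi
      omega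
    · refine fun x hx _ => ⟨N', hN', hx, fun W hW hWne hWN hWi Q y => hright W Q y hW hWne ?_⟩
      have := hY'.numLarge_mono hε3 (hWN.trans inter_subset_left)
      omega
  by_cases hbig' : ∃ i', 3 * ε ≤ diam (Y' i') ∧ Y' i' ⊆ N'
  · obtain ⟨i', hid, hiN⟩ := hbig'
    obtain ⟨i, hi, ⟨φ⟩⟩ := hY'Y.exists_subset i' hN hne
    have hlt : 0 < numLarge Y' (3 * ε) N' :=
      (ncard_pos ((hY'.finite_diam _ hε3).subset fun _ hi => hi.1)).2 ⟨i', hid, hiN⟩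
    refine .of_homeomorph hY hY' hε φ.symm hN hN' hi hiN ?_ ?_
    · refine fun x hx _ => ⟨N, hN, hx, fun W hW hWne hWN hWi Q y => hleft W Q y hW hWne ?_⟩
      have := hY.numLarge_mono hε3 (hWN.trans inter_subset_left)
      omega
    · refine fun x hx _ => ⟨N', hN', hx, fun W hW hWne hWN hWi Q y => hright W Q y hW hWne ?_⟩
      have := hY'.numLarge_lt hε3 (hWN.trans inter_subset_left) hid hiN hWi
      omega
  push Not at hbig hbig'
  obtain ⟨i', hi', -⟩ := hYY'.exists_subset i₀ hN' hne'
  obtain ⟨i, hi, ⟨φ⟩⟩ := hY'Y.exists_subset i' hN hne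
  have hl : IsLocallyRefinable Y Y' ε i N := by
    intro x hx _
    obtain ⟨V, hV, hxV, hVx⟩ := hY.exists_isSaturatedClopen isOpen_ball (mem_ball_self hε3)
      fun j hj => subset_ball_of_diam_lt hj (not_le.1 fun hd => hbig j hd (hN.subset_of_mem hj hx))
    refine ⟨V, hV, hxV, fun W hW hWne hWV _ Q y hQ hQne hQy =>
      .of_diam_le hY hYY' hY'Y hW hQ hWne hQne i ?_ ?_⟩
    · refine (diam_mono (hWV.trans (inter_subset_right.trans hVx)) isBounded_ball).trans
        ((diam_ball hε3.le).trans (by linarith))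
    · linarith [diam_lt_of_subset_ball hε hQy]
  have hl' : IsLocallyRefinable Y' Y ε i' N' := by
    intro x hx _
    obtain ⟨V, hV, hxV, hVx⟩ := hY'.exists_isSaturatedClopen isOpen_ball (mem_ball_self hε3)
      fun j hj => subset_ball_of_diam_lt hj
        (not_le.1 fun hd => hbig' j hd (hN'.subset_of_mem hj hx))
    refine ⟨V, hV, hxV, fun W hW hWne hWV _ Q y hQ hQne hQy =>
      .of_diam_le hY' hY'Y hYY' hW hQ hWne hQne i' ?_ ?_⟩
    · refine (diam_mono (hWV.trans (inter_subset_right.trans hVx)) isBounded_ball).trans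
        ((diam_ball hε3.le).trans (by linarith))
    · linarith [diam_lt_of_subset_ball hε hQy]
  exact .of_homeomorph hY hY' hε φ.symm hN hN' hi hi' hl hl'

theorem IsApprox.isRefinable (hY : IsNullFamily Y) (hY' : IsNullFamily Y')
    (hYY' : HasDenseCopies Y Y') (hY'Y : HasDenseCopies Y' Y) {ε : ℝ} (hε : 0 < ε) {N : Set Z}
    {N' : Set Z'} {R : Set (Z × Z')} (h : IsApprox Y Y' N N' R) :
    IsRefinable Y Y' (6 * ε) N N' R := by
  induction h with
  | @core i i' φ N N' δ hN hN' hi hi' hδ hn hn' =>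
    refine .of_isLocallyRefinable hY hY' hε hδ φ hN hN' hi hi' hn hn' ?_ ?_
    · exact fun x hx _ => ⟨N, hN, hx, fun W hW hWne _ _ Q y hQ hQne _ =>
        isRefinable_prod hY hY' hYY' hY'Y i hε hW hQ hWne hQne⟩
    · exact fun x hx _ => ⟨N', hN', hx, fun W hW hWne _ _ Q y hQ hQne _ =>
        isRefinable_prod hY' hY hY'Y hYY' i' hε hW hQ hWne hQne⟩
  | union _ _ hd hd' ih₁ ih₂ => exact ih₁.union ih₂ hd hd'

omit [CompactSpace Z] in
-- The fibres over `z` are nested nonempty compact sets with diameters tending to zero.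
theorem exists_unique_of_antitone_isClosed {R : ℕ → Set (Z × Z')} (hR : Antitone R)
    (hc : ∀ n, IsClosed (R n)) (hs : ∀ n z, ∃ z', (z, z') ∈ R n)
    (hf : ∀ ε > 0, ∃ n, ∀ z z₁ z₂, (z, z₁) ∈ R n → (z, z₂) ∈ R n → dist z₁ z₂ ≤ ε) :
    ∀ z, ∃! z', (z, z') ∈ ⋂ n, R n := by
  intro z
  obtain ⟨z', hz'⟩ := IsCompact.nonempty_iInter_of_sequence_nonempty_isCompact_isClosed
    (fun n => {z' | (z, z') ∈ R n}) (fun n z' h => hR n.le_succ h) (fun n => hs n z)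
    ((hc 0).preimage (by fun_prop)).isCompact (fun n => (hc n).preimage (by fun_prop))
  rw [mem_iInter] at hz'
  refine ⟨z', mem_iInter.2 hz', fun w hw => ?_⟩
  have hw := mem_iInter.1 hw
  refine dist_le_zero.1 (le_of_forall_pos_le_add fun ε hε => ?_)
  obtain ⟨n, hn⟩ := hf ε hε
  simpa using hn z w z' (hw n) (hz' n)

/-- Two compact metric spaces with null families each of which has dense copies of the members of
the other are homeomorphic. -/
theorem IsNullFamily.nonempty_homeomorph [Nonempty ι] [Nonempty Z] [Nonempty Z']
    (hY : IsNullFamily Y) (hY' : IsNullFamily Y') (hYY' : HasDenseCopies Y Y')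
    (hY'Y : HasDenseCopies Y' Y) : Nonempty (Z ≃ₜ Z') := by
  obtain ⟨i₀⟩ := ‹Nonempty ι›
  have step : ∀ (n : ℕ) (R : {R : Set (Z × Z') // IsApprox Y Y' univ univ R}),
      ∃ R₁ : {R : Set (Z × Z') // IsApprox Y Y' univ univ R}, R₁.1 ⊆ R.1 ∧
        IsFine (6 * (1 / ((n : ℝ) + 1))) R₁.1 := by
    rintro n ⟨R, hR⟩
    obtain ⟨R₁, h1, h2, h3⟩ := hR.isRefinable hY hY' hYY' hY'Y (Nat.one_div_pos_of_nat (n := n))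
    exact ⟨⟨R₁, h2⟩, h1, h3⟩
  choose next hsub hfine using step
  obtain ⟨R₀, -, hR₀, -⟩ := isRefinable_prod hY hY' hYY' hY'Y i₀ one_pos .univ .univ univ_nonempty
    univ_nonempty
  let R : ℕ → {R : Set (Z × Z') // IsApprox Y Y' univ univ R} :=
    fun n => Nat.rec ⟨R₀, hR₀⟩ next n
  have hanti : Antitone fun n => (R n).1 := antitone_nat_of_succ_le fun n => hsub n (R n)
  have hfineR : ∀ ε > 0, ∃ n, IsFine ε (R n).1 := by
    intro ε hε
    obtain ⟨n, hn⟩ := exists_nat_one_div_lt (show 0 < ε / 6 by positivity)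
    refine ⟨n + 1, ?_⟩
    have h := hfine n (R n)
    exact ⟨fun z z₁ z₂ h1 h2 => (h.1 z z₁ z₂ h1 h2).trans (by linarith),
      fun z z₁ z₂ h1 h2 => (h.2 z z₁ z₂ h1 h2).trans (by linarith)⟩
  have hclosed : ∀ n, IsClosed (R n).1 := fun n => (R n).2.isClosed hY
  have h1 := exists_unique_of_antitone_isClosed hanti hclosed
    (fun n z => (R n).2.exists_mem (mem_univ z))
    fun ε hε => (hfineR ε hε).imp fun n h => h.1
  have h2 := exists_unique_of_antitone_isClosed (R := fun n => Prod.swap ⁻¹' (R n).1)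
    (fun m n hmn => preimage_mono (hanti hmn)) (fun n => (hclosed n).preimage continuous_swap)
    (fun n z => (R n).2.swap.exists_mem (mem_univ z))
    fun ε hε => (hfineR ε hε).imp fun n h => h.2
  -- Both projections of the compact set `G` are continuous bijections, hence homeomorphisms.
  set G := ⋂ n, (R n).1 with hG
  have hGc : IsClosed G := isClosed_iInter hclosed
  have : CompactSpace G := isCompact_iff_compactSpace.1 hGc.isCompact
  have b1 : Function.Bijective fun q : G => q.1.1 := by
    refine ⟨?_, fun z => ?_⟩
    · rintro ⟨⟨z, z₁⟩, hz₁⟩ ⟨⟨w, z₂⟩, hz₂⟩ (rfl : z = w)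
      obtain rfl := (h1 z).unique hz₁ hz₂
      rfl
    · obtain ⟨z', hz', -⟩ := h1 z
      exact ⟨⟨(z, z'), hz'⟩, rfl⟩
  have b2 : Function.Bijective fun q : G => q.1.2 := by
    rw [← preimage_iInter] at h2
    refine ⟨?_, fun z => ?_⟩
    · rintro ⟨⟨z₁, z⟩, hz₁⟩ ⟨⟨z₂, w⟩, hz₂⟩ (rfl : z = w)
      obtain rfl := (h2 z).unique hz₁ hz₂
      rfl
    · obtain ⟨z', hz', -⟩ := h2 z
      exact ⟨⟨(z', z), hz'⟩, rfl⟩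
  have e1 : G ≃ₜ Z := Continuous.homeoOfEquivCompactToT2 (f := Equiv.ofBijective _ b1)
    (continuous_fst.comp continuous_subtype_val)
  have e2 : G ≃ₜ Z' := Continuous.homeoOfEquivCompactToT2 (f := Equiv.ofBijective _ b2)
    (continuous_snd.comp continuous_subtype_val)
  exact ⟨e1.symm.trans e2⟩

end DenseFamily

/-! ### Tails and decay of Floyd functions. -/

namespace FloydFunction

open Filter Topology

variable (f : FloydFunction)

theorem tendsto_zero : Tendsto f atTop (𝓝 0) := f.summable.tendsto_atTop_zero

/-- The tail `∑ f k` over `k ≥ n`. -/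
noncomputable def tail (n : ℕ) : ℝ := ∑' k, f (k + n)

theorem summable_add (n : ℕ) : Summable fun k => f (k + n) := (summable_nat_add_iff n).2 f.summable

theorem tail_antitone : Antitone f.tail := fun _ _ h =>
  (f.summable_add _).tsum_le_tsum (fun k => f.antitone (Nat.add_le_add_left h k)) (f.summable_add _)

theorem tendsto_tail : Tendsto f.tail atTop (𝓝 0) := tendsto_sum_nat_add f

theorem sum_le_tail (m n : ℕ) : ∑ k ∈ Finset.range m, f (k + n) ≤ f.tail n :=
  (f.summable_add n).sum_le_tsum _ fun _ _ => (f.pos _).le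

theorem exists_le_mul_add (m : ℕ) : ∃ K, 0 < K ∧ ∀ n, f n ≤ K * f (n + m) := by
  obtain ⟨c, hc, h⟩ := f.ratio
  refine ⟨(c ^ m)⁻¹, by positivity, fun n => ?_⟩
  rw [← div_eq_inv_mul, le_div_iff₀' (by positivity)]
  induction m with
  | zero => simp
  | succ m ih =>
    calc c ^ (m + 1) * f n = c * (c ^ m * f n) := by ring
      _ ≤ c * f (n + m) := by gcongr
      _ ≤ f (n + (m + 1)) := (h (n + m)).2

theorem exists_le_mul_of_le_add (m : ℕ) : ∃ K, 0 < K ∧ ∀ a b, b ≤ a + m → f a ≤ K * f b := by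
  obtain ⟨K, hK, h⟩ := f.exists_le_mul_add m
  refine ⟨K, hK, fun a b hab => (h a).trans ?_⟩
  gcongr
  exact f.antitone hab

end FloydFunction

/-! ### Word length and Floyd metric. -/

namespace GeneratingSet

open Filter Topology SimpleGraph

variable {G : Type*} [Group G] (S : GeneratingSet G) (f : FloydFunction)

theorem cayley_connected : S.cayley.Connected := ⟨S.cayley_reachable⟩

theorem cayley_adj_mul_left (x : G) {g h : G} (hadj : S.cayley.Adj g h) :
    S.cayley.Adj (x * g) (x * h) := by
  obtain ⟨hne, s, hs, h1⟩ := S.cayley_adj.1 hadj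
  refine S.cayley_adj.2 ⟨fun h => hne (mul_left_cancel h), s, hs, ?_⟩
  rcases h1 with rfl | rfl
  · exact Or.inl (mul_assoc x g s)
  · exact Or.inr (mul_assoc x h s).symm

theorem dist_mul_left_le (x g h : G) : S.cayley.dist (x * g) (x * h) ≤ S.cayley.dist g h := by
  obtain ⟨p, hp⟩ := S.cayley_connected.exists_walk_length_eq_dist g h
  rw [← hp, ← Walk.length_map (f := (⟨fun g => x * g, fun h => S.cayley_adj_mul_left x h⟩ :
    S.cayley →g S.cayley)) (p := p)]
  exact SimpleGraph.dist_le _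

theorem dist_eq_wordLength (g h : G) : S.cayley.dist g h = S.wordLength (g⁻¹ * h) := by
  apply le_antisymm
  · simpa [wordLength] using S.dist_mul_left_le g 1 (g⁻¹ * h)
  · simpa [wordLength] using S.dist_mul_left_le g⁻¹ g h

@[simp]
theorem wordLength_one : S.wordLength 1 = 0 := by simp [wordLength]

theorem wordLength_eq_zero {g : G} : S.wordLength g = 0 ↔ g = 1 := by
  rw [wordLength, S.cayley_connected.dist_eq_zero_iff, eq_comm]

theorem wordLength_mul_le (g h : G) : S.wordLength (g * h) ≤ S.wordLength g + S.wordLength h := by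
  have h1 : S.cayley.dist 1 (g * h) ≤ S.cayley.dist 1 g + S.cayley.dist g (g * h) :=
    S.cayley_connected.dist_triangle
  rwa [S.dist_eq_wordLength g, inv_mul_cancel_left] at h1

theorem wordLength_inv (g : G) : S.wordLength g⁻¹ = S.wordLength g := by
  have := S.dist_eq_wordLength g 1
  rw [mul_one] at this
  rw [← this, dist_comm, wordLength]

theorem wordLength_inv_mul_of_adj {g h : G} (hadj : S.cayley.Adj g h) :
    S.wordLength (g⁻¹ * h) = 1 := by
  rw [← dist_eq_wordLength, dist_eq_one_iff_adj]
  exact hadj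

theorem wordLength_le_of_adj {g h : G} (hadj : S.cayley.Adj g h) :
    S.wordLength h ≤ S.wordLength g + 1 := by
  have := S.wordLength_mul_le g (g⁻¹ * h)
  rwa [S.wordLength_inv_mul_of_adj hadj, mul_inv_cancel_left] at this

theorem exists_adj_of_ne {g u : G} (hne : g ≠ u) :
    ∃ h, S.cayley.Adj g h ∧ S.wordLength (h⁻¹ * u) + 1 = S.wordLength (g⁻¹ * u) := by
  obtain ⟨p, hp⟩ := S.cayley_connected.exists_walk_length_eq_dist g u
  rw [S.dist_eq_wordLength] at hp
  cases p with
  | nil => exact absurd rfl hne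
  | @cons _ h _ e q =>
    refine ⟨h, e, le_antisymm ?_ ?_⟩
    · rw [← hp, Walk.length_cons, ← S.dist_eq_wordLength]
      exact Nat.succ_le_succ (SimpleGraph.dist_le q)
    · have := S.wordLength_mul_le (g⁻¹ * h) (h⁻¹ * u)
      rw [S.wordLength_inv_mul_of_adj e, mul_assoc, mul_inv_cancel_left] at this
      omega

theorem finite_wordLength_le (n : ℕ) : {g | S.wordLength g ≤ n}.Finite := by
  induction n with
  | zero =>
    refine (Set.finite_singleton 1).subset fun g hg => ?_
    exact S.wordLength_eq_zero.1 (Nat.le_zero.1 hg)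
  | succ n ih =>
    refine (ih.union ((ih.image2 (fun g s => g * s) S.finite).union
      (ih.image2 (fun g s => g * s⁻¹) S.finite))).subset fun g hg => ?_
    by_cases hg1 : g = 1
    · left; simp [hg1]
    right
    obtain ⟨h, hadj, hh⟩ := S.exists_adj_of_ne hg1
    rw [mul_one, mul_one, S.wordLength_inv, S.wordLength_inv] at hh
    have hn : S.wordLength h ≤ n := by
      have : S.wordLength g ≤ n + 1 := hg
      omega
    obtain ⟨-, s, hs, hs' | hs'⟩ := S.cayley_adj.1 hadj
    · exact Or.inr ⟨h, hn, s, hs, by simp [← hs']⟩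
    · exact Or.inl ⟨h, hn, s, hs, hs'.symm⟩

theorem tendsto_wordLength : Tendsto S.wordLength cofinite atTop := by
  refine tendsto_atTop.2 fun n => ?_
  filter_upwards [(S.finite_wordLength_le n).compl_mem_cofinite] with g hg
  exact (not_le.1 (show ¬ S.wordLength g ≤ n from hg)).le

theorem edgeLength_le_of_adj {g h : G} (hadj : S.cayley.Adj g h) :
    S.edgeLength f g h ≤ f (S.wordLength g - 1) := by
  have := S.wordLength_le_of_adj hadj.symm
  exact f.antitone (by omega)

theorem floydDist_nonneg (g h : G) : 0 ≤ S.floydDist f g h :=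
  Real.iInf_nonneg fun p => S.pathLength_nonneg f p

theorem floydDist_comm (g h : G) : S.floydDist f g h = S.floydDist f h g :=
  le_antisymm (S.floydDist_comm_le f g h) (S.floydDist_comm_le f h g)

theorem floydDist_le_edgeLength {g h : G} (hadj : S.cayley.Adj g h) :
    S.floydDist f g h ≤ S.edgeLength f g h :=
  (S.floydDist_le f hadj.toWalk).trans (by simp [pathLength])

/-- A pseudometric bounded by a multiple of the Floyd length on edges is bounded by the same
multiple of the Floyd metric. -/
theorem le_mul_floydDist {d : G → G → ℝ} (hself : ∀ g, d g g = 0)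
    (htri : ∀ g h k, d g k ≤ d g h + d h k) {K : ℝ} (hK : 0 ≤ K)
    (hadj : ∀ g h, S.cayley.Adj g h → d g h ≤ K * S.edgeLength f g h) (g h : G) :
    d g h ≤ K * S.floydDist f g h := by
  have : Nonempty (S.cayley.Walk g h) := S.cayley_reachable g h
  rw [floydDist, Real.mul_iInf_of_nonneg hK]
  refine le_ciInf fun p => ?_
  induction p with
  | nil => simp [hself, pathLength]
  | @cons a b c e p ih =>
    have h1 := ih ⟨p⟩
    have h2 := hadj a b e
    have h3 := htri a b c
    simp only [pathLength, Walk.darts_cons, List.map_cons, List.sum_cons] at h1 ⊢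
    linarith

theorem floydDist_map_le {H : Type*} [Group H] (S' : GeneratingSet H) (f' : FloydFunction)
    (φ : G → H) {K : ℝ} (hK : 0 ≤ K)
    (hadj : ∀ g h, S.cayley.Adj g h → S'.floydDist f' (φ g) (φ h) ≤ K * S.edgeLength f g h)
    (g h : G) : S'.floydDist f' (φ g) (φ h) ≤ K * S.floydDist f g h :=
  S.le_mul_floydDist f (d := fun g h => S'.floydDist f' (φ g) (φ h))
    (fun _ => S'.floydDist_self f' _) (fun _ _ _ => S'.floydDist_triangle f' _ _ _) hK hadj g h

/-- The Floyd distance is bounded by the tail of the Floyd function along geodesics which move away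
from the identity. -/
theorem floydDist_le_tail {w u : G}
    (h : S.wordLength u = S.wordLength w + S.wordLength (w⁻¹ * u)) :
    S.floydDist f w u ≤ f.tail (S.wordLength w) := by
  suffices ∀ m w, S.wordLength u = S.wordLength w + S.wordLength (w⁻¹ * u) →
      S.wordLength (w⁻¹ * u) = m →
      S.floydDist f w u ≤ ∑ k ∈ Finset.range m, f (k + S.wordLength w) from
    (this _ w h rfl).trans (f.sum_le_tail _ _)
  intro m
  induction m with
  | zero =>
    intro w _ hm
    rw [S.wordLength_eq_zero, inv_mul_eq_one] at hm
    simp [hm, floydDist_self]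
  | succ m ih =>
    intro w hw hm
    have hne : w ≠ u := by
      rintro rfl
      simp at hm
    obtain ⟨v, hv, hvu⟩ := S.exists_adj_of_ne hne
    have h1 := S.wordLength_le_of_adj hv
    have h2 := S.wordLength_mul_le v (v⁻¹ * u)
    rw [mul_inv_cancel_left] at h2
    have hvw : S.wordLength v = S.wordLength w + 1 := by omega
    have h3 := ih v (by omega) (by omega)
    have h4 := S.floydDist_le_edgeLength f hv
    rw [edgeLength, hvw, min_eq_left (Nat.le_succ _)] at h4
    rw [Finset.sum_range_succ', zero_add]
    refine (S.floydDist_triangle f w v u).trans ?_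
    rw [add_comm]
    refine add_le_add (h3.trans (le_of_eq (Finset.sum_congr rfl fun k _ => ?_))) h4
    rw [hvw]
    congr 1
    ring

/-- A geodesic from `g` to `g * r` has `wordLength r` edges, and none comes closer to the identity
than `wordLength g - wordLength r`. -/
theorem floydDist_mul_right_le (g r : G) :
    S.floydDist f g (g * r) ≤ S.wordLength r * f (S.wordLength g - S.wordLength r) := by
  suffices ∀ n g u, S.wordLength (g⁻¹ * u) = n →
      S.floydDist f g u ≤ n * f (S.wordLength g - n) from
    this (S.wordLength r) g (g * r) (by simp)
  intro n
  induction n with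
  | zero =>
    intro g u h
    rw [S.wordLength_eq_zero, inv_mul_eq_one] at h
    simp [h, floydDist_self]
  | succ n ih =>
    intro g u h
    have hne : g ≠ u := by
      rintro rfl
      simp at h
    obtain ⟨v, hv, hvu⟩ := S.exists_adj_of_ne hne
    have h1 := S.wordLength_le_of_adj hv.symm
    have h2 := ih v u (by omega)
    have h3 := (S.floydDist_le_edgeLength f hv).trans (S.edgeLength_le_of_adj f hv)
    have h4 : f (S.wordLength g - 1) ≤ f (S.wordLength g - (n + 1)) := f.antitone (by omega)
    have h5 : f (S.wordLength v - n) ≤ f (S.wordLength g - (n + 1)) := f.antitone (by omega)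
    have h6 := S.floydDist_triangle f g v u
    have h7 : (n : ℝ) * f (S.wordLength v - n) ≤ n * f (S.wordLength g - (n + 1)) := by gcongr
    push_cast
    linarith

theorem tendsto_floydDist_mul_right (r : G) :
    Tendsto (fun g => S.floydDist f g (g * r)) cofinite (𝓝 0) := by
  have h1 : Tendsto (fun g => S.wordLength g - S.wordLength r) cofinite atTop :=
    (tendsto_sub_atTop_nat _).comp S.tendsto_wordLength
  have h2 := (f.tendsto_zero.comp h1).const_mul (S.wordLength r : ℝ)
  rw [mul_zero] at h2
  exact squeeze_zero (fun g => S.floydDist_nonneg f _ _) (fun g => S.floydDist_mul_right_le f g r) h2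

/-- Left translation by `x` changes word lengths by at most `wordLength x`, hence edge lengths by a
bounded factor. -/
theorem exists_floydDist_mul_left_le (x : G) :
    ∃ K, 0 ≤ K ∧ ∀ g h, S.floydDist f (x * g) (x * h) ≤ K * S.floydDist f g h := by
  obtain ⟨K, hK, h⟩ := f.exists_le_mul_of_le_add (S.wordLength x)
  refine ⟨K, hK.le, S.floydDist_map_le f S f (fun g => x * g) hK.le fun g k hadj => ?_⟩
  refine (S.floydDist_le_edgeLength f (S.cayley_adj_mul_left x hadj)).trans (h _ _ ?_)
  have h1 := S.wordLength_mul_le x⁻¹ (x * g)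
  have h2 := S.wordLength_mul_le x⁻¹ (x * k)
  rw [inv_mul_cancel_left, wordLength_inv] at h1 h2
  omega

/-- The first edge of a path leaving `g` is already this long; it follows that vertices are isolated
in the completion. -/
theorem le_floydDist {g h : G} (hne : g ≠ h) : f (S.wordLength g) ≤ S.floydDist f g h := by
  have : Nonempty (S.cayley.Walk g h) := S.cayley_reachable g h
  refine le_ciInf fun p => ?_
  cases p with
  | nil => exact absurd rfl hne
  | @cons _ k _ e q =>
    have h1 : f (S.wordLength g) ≤ S.edgeLength f g k := f.antitone (min_le_left _ _)
    have h2 := S.pathLength_nonneg f q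
    simp only [pathLength, Walk.darts_cons, List.map_cons, List.sum_cons] at h2 ⊢
    linarith

end GeneratingSet

/-! ### The Floyd completion and its compactness. -/

/-- The completion of the Floyd metric. -/
abbrev FloydCompletion {G : Type u} [Group G] (f : FloydFunction) (S : GeneratingSet G) : Type u :=
  UniformSpace.Completion (FloydSpace f S)

namespace FloydCompletion

open Filter Topology

variable {G H : Type u} [Group G] [Group H]

/-- A group element as a point of the Floyd completion. -/
noncomputable def vertex (f : FloydFunction) (S : GeneratingSet G) (g : G) : FloydCompletion f S :=
  UniformSpace.Completion.coe' (α := FloydSpace f S) g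

variable {f f' : FloydFunction} {S : GeneratingSet G} {S' : GeneratingSet H}

theorem dist_vertex (g h : G) : dist (vertex f S g) (vertex f S h) = S.floydDist f g h :=
  UniformSpace.Completion.dist_eq (α := FloydSpace f S) g h

theorem denseRange_vertex : DenseRange (vertex f S) :=
  UniformSpace.Completion.denseRange_coe (α := FloydSpace f S)

theorem vertex_injective : Function.Injective (vertex f S) :=
  UniformSpace.Completion.coe_injective (FloydSpace f S)

theorem eq_vertex_of_dist_lt {x : FloydCompletion f S} {g : G}
    (h : dist x (vertex f S g) < f (S.wordLength g)) : x = vertex f S g := by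
  by_contra hne
  obtain ⟨k, hk⟩ := denseRange_vertex.exists_mem_open
    ((Metric.isOpen_ball (x := vertex f S g) (ε := f (S.wordLength g))).sdiff
      isClosed_singleton) ⟨x, h, hne⟩
  have hkg : g ≠ k := fun h => hk.2 (by rw [h]; rfl)
  have h1 : dist (vertex f S k) (vertex f S g) < f (S.wordLength g) := hk.1
  rw [dist_vertex, GeneratingSet.floydDist_comm] at h1
  exact absurd (S.le_floydDist f hkg) (not_le.2 h1)

theorem isOpen_singleton_vertex (g : G) : IsOpen {vertex f S g} := by
  convert Metric.isOpen_ball (x := vertex f S g) (ε := f (S.wordLength g)) using 1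
  ext x
  refine ⟨?_, eq_vertex_of_dist_lt⟩
  rintro rfl
  exact Metric.mem_ball_self (f.pos _)

variable (f S) in
theorem isOpen_range_vertex : IsOpen (Set.range (vertex f S)) := by
  rw [← Set.iUnion_singleton_eq_range]
  exact isOpen_iUnion isOpen_singleton_vertex

/-- The trace on the group of the neighbourhood filter of a point of the Floyd completion. -/
noncomputable def trace (x : FloydCompletion f S) : Filter G := comap (vertex f S) (𝓝 x)

instance (x : FloydCompletion f S) : (trace x).NeBot :=
  comap_neBot fun _ ht => by
    obtain ⟨U, hU, hUo, hxU⟩ := mem_nhds_iff.1 ht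
    exact (denseRange_vertex.exists_mem_open hUo ⟨x, hxU⟩).imp fun _ h => hU h

theorem tendsto_vertex_trace (x : FloydCompletion f S) : Tendsto (vertex f S) (trace x) (𝓝 x) :=
  tendsto_comap

theorem trace_le_cofinite {x : FloydCompletion f S} (hx : x ∉ Set.range (vertex f S)) :
    trace x ≤ cofinite := by
  refine le_cofinite_iff_compl_singleton_mem.2 fun g => ?_
  refine mem_comap.2 ⟨{vertex f S g}ᶜ, isOpen_compl_singleton.mem_nhds fun h => hx ⟨g, h.symm⟩, ?_⟩
  rintro h hh rfl
  exact hh rfl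

theorem exists_wordLength_eq (S : GeneratingSet G) (u : G) (n : ℕ) (hn : n ≤ S.wordLength u) :
    ∃ g, S.wordLength g = n ∧ S.wordLength u = S.wordLength g + S.wordLength (g⁻¹ * u) := by
  induction n with
  | zero => exact ⟨1, by simp, by simp⟩
  | succ n ih =>
    obtain ⟨g, h1, h2⟩ := ih (by omega)
    obtain ⟨h, hadj, hh⟩ := S.exists_adj_of_ne (g := g) (u := u) (by rintro rfl; omega)
    have h3 := S.wordLength_le_of_adj hadj
    have h4 := S.wordLength_mul_le h (h⁻¹ * u)
    rw [mul_inv_cancel_left] at h4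
    exact ⟨h, by omega, by omega⟩

variable (f S) in
-- A geodesic from the identity to `u` crosses the sphere of radius `n` and has Floyd length at most
-- `f.tail n` from there on, so the finite ball of radius `n` is an `ε`-net.
theorem totallyBounded_univ : TotallyBounded (Set.univ : Set (FloydSpace f S)) := by
  rw [Metric.totallyBounded_iff]
  intro ε hε
  obtain ⟨n, hn⟩ := (f.tendsto_tail.eventually_lt_const hε).exists
  have key : ∀ u : G, ∃ g, S.wordLength g ≤ n ∧ S.floydDist f u g < ε := by
    intro u
    by_cases hu : S.wordLength u ≤ n
    · exact ⟨u, hu, by rwa [S.floydDist_self]⟩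
    obtain ⟨g, h1, h2⟩ := exists_wordLength_eq S u n (not_le.1 hu).le
    refine ⟨g, h1.le, ?_⟩
    rw [S.floydDist_comm]
    exact (S.floydDist_le_tail f h2).trans_lt (h1 ▸ hn)
  refine ⟨{g : G | S.wordLength g ≤ n}, S.finite_wordLength_le n, fun u _ => ?_⟩
  obtain ⟨g, h1, h2⟩ := key u
  exact Set.mem_biUnion (x := g) h1 h2

instance : CompactSpace (FloydCompletion f S) := by
  refine ⟨TotallyBounded.isCompact_of_isClosed ?_ isClosed_univ⟩
  rw [← (UniformSpace.Completion.denseRange_coe (α := FloydSpace f S)).closure_range,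
    ← Set.image_univ]
  exact ((totallyBounded_univ f S).image
    (UniformSpace.Completion.uniformContinuous_coe _)).closure

/-- The extension to Floyd completions of a map between groups. -/
noncomputable def map (f : FloydFunction) (S : GeneratingSet G) (f' : FloydFunction)
    (S' : GeneratingSet H) (φ : G → H) : FloydCompletion f S → FloydCompletion f' S' :=
  UniformSpace.Completion.map (α := FloydSpace f S) (β := FloydSpace f' S') φ

theorem uniformContinuous_of_le {φ : G → H}
    (h : ∃ K, 0 ≤ K ∧ ∀ g k, S'.floydDist f' (φ g) (φ k) ≤ K * S.floydDist f g k) :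
    UniformContinuous (α := FloydSpace f S) (β := FloydSpace f' S') φ := by
  obtain ⟨K, hK, h⟩ := h
  exact (LipschitzWith.of_dist_le_mul (α := FloydSpace f S) (β := FloydSpace f' S')
    (K := ⟨K, hK⟩) h).uniformContinuous

theorem continuous_map (φ : G → H) : Continuous (map f S f' S' φ) :=
  UniformSpace.Completion.continuous_map

theorem map_vertex {φ : G → H}
    (h : ∃ K, 0 ≤ K ∧ ∀ g k, S'.floydDist f' (φ g) (φ k) ≤ K * S.floydDist f g k) (g : G) :
    map f S f' S' φ (vertex f S g) = vertex f' S' (φ g) :=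
  UniformSpace.Completion.map_coe (uniformContinuous_of_le h) (a := g)

theorem eq_of_forall_vertex {X : Type*} [TopologicalSpace X] [T2Space X]
    {φ ψ : FloydCompletion f S → X} (hφ : Continuous φ) (hψ : Continuous ψ)
    (h : ∀ g, φ (vertex f S g) = ψ (vertex f S g)) (x : FloydCompletion f S) : φ x = ψ x :=
  congr_fun (denseRange_vertex.equalizer hφ hψ (funext h)) x

variable (f S) in
-- Otherwise the completion would be compact and discrete, hence finite.
theorem exists_notMem_range_vertex [Infinite G] : ∃ x, x ∉ Set.range (vertex f S) := by
  by_contra! h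
  have : DiscreteTopology (FloydCompletion f S) := by
    refine discreteTopology_iff_isOpen_singleton.2 fun x => ?_
    obtain ⟨g, rfl⟩ := h x
    exact isOpen_singleton_vertex g
  have : Finite (FloydCompletion f S) := finite_of_compact_of_discrete
  exact not_finite_iff_infinite.2 ‹Infinite G›
    (Finite.of_injective _ (vertex_injective (f := f) (S := S)))

end FloydCompletion

/-! ### Elementary groups have countable completions. -/

/-- Some radius is not a distance to `x`, and for it the open and the closed ball coincide. -/
theorem exists_isClopen_of_countable {X : Type*} [MetricSpace X] [Countable X] {x y : X}
    (h : x ≠ y) : ∃ K : Set X, IsClopen K ∧ x ∈ K ∧ y ∉ K := by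
  obtain ⟨r, ⟨hr, hry⟩, hd⟩ : ∃ r ∈ Set.Ioo 0 (dist y x), r ∉ Set.range fun z => dist z x := by
    by_contra! hcon
    have h1 : (Set.Ioo 0 (dist y x)).Countable := (Set.countable_range _).mono hcon
    have h2 := Cardinal.le_aleph0_iff_set_countable.2 h1
    rw [Cardinal.mk_Ioo_real (dist_pos.2 h.symm)] at h2
    exact Cardinal.aleph0_lt_continuum.not_ge h2
  refine ⟨Metric.ball x r, ⟨?_, Metric.isOpen_ball⟩, Metric.mem_ball_self hr, fun hy => ?_⟩
  · convert Metric.isClosed_closedBall (x := x) (ε := r) using 1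
    ext z
    exact ⟨fun hz => Metric.ball_subset_closedBall hz,
      fun hz => lt_of_le_of_ne hz fun hz => hd ⟨z, hz⟩⟩
  · exact absurd hry (not_lt.2 (le_of_lt hy))

/-- After `M * a` terms the truncated subtraction is harmless and every value of `f` is repeated `M`
times. -/
theorem FloydFunction.summable_div (f : FloydFunction) {M : ℕ} (hM : 0 < M) (a : ℕ) :
    Summable fun n => f (n / M - a) := by
  rw [← summable_nat_add_iff (M * a)]
  simp only [Nat.add_mul_div_left _ _ hM, Nat.add_sub_cancel]
  have : NeZero M := ⟨hM.ne'⟩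
  rw [← (Nat.divModEquiv M).symm.summable_iff]
  have h : Summable fun p : ℕ × Fin M => f p.1 := by
    refine (summable_prod_of_nonneg fun p => (f.pos _).le).2 ⟨fun _ => .of_finite, ?_⟩
    simpa using f.summable.mul_left (M : ℝ)
  refine (summable_congr fun p => ?_).2 h
  have h1 : (p.1 * M + p.2) / M = p.1 := by
    rw [mul_comm, Nat.mul_add_div hM, Nat.div_eq_of_lt p.2.2, add_zero]
  simp [Nat.divModEquiv, h1]

namespace GeneratingSet

open Filter Topology FloydCompletion

variable {G : Type u} [Group G] (S : GeneratingSet G) (f : FloydFunction)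

include S in
theorem countable_of_finite : Countable G := by
  have : (⋃ n, {g | S.wordLength g ≤ n}).Countable :=
    Set.countable_iUnion fun n => (S.finite_wordLength_le n).countable
  refine Set.countable_univ_iff.1 (this.mono fun g _ => Set.mem_iUnion.2 ⟨S.wordLength g, ?_⟩)
  exact le_refl (S.wordLength g)

theorem cauchySeq_vertex_pow {c : G} {M : ℕ} (hM : 0 < M)
    (h : ∀ n, n ≤ M * S.wordLength (c ^ n)) : CauchySeq fun n => vertex f S (c ^ n) := by
  refine cauchySeq_of_dist_le_of_summable (fun n => S.wordLength c * f (n / M - S.wordLength c))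
    (fun n => ?_) ((f.summable_div hM _).mul_left _)
  rw [dist_vertex, pow_succ]
  refine (S.floydDist_mul_right_le f _ _).trans ?_
  gcongr
  exact f.antitone (Nat.sub_le_sub_right (Nat.div_le_of_le_mul (h n)) _)

theorem tendsto_pow_cofinite {c : G} {M : ℕ} (h : ∀ n, n ≤ M * S.wordLength (c ^ n)) :
    Tendsto (fun n => c ^ n) atTop cofinite := by
  refine le_cofinite_iff_compl_singleton_mem.2 fun g => ?_
  rw [mem_map]
  filter_upwards [eventually_gt_atTop (M * S.wordLength g)] with n hn hng
  have hng : c ^ n = g := hng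
  have := h n
  rw [hng] at this
  omega

variable {S f} in
-- Along `U`, the elements `g` and `c ^ σ g` differ by right multiplication by one of finitely many
-- elements, so their Floyd distance tends to zero.
theorem eq_of_tendsto_pow {x e : FloydCompletion f S} {c : G} {M : ℕ}
    (h : ∀ n, n ≤ M * S.wordLength (c ^ n)) (he : Tendsto (fun n => vertex f S (c ^ n)) atTop (𝓝 e))
    {U : Filter G} [U.NeBot] (hU : U ≤ trace x) {r : G → G} (hr : (Set.range r).Finite) {σ : G → ℕ}
    (hσ : Tendsto σ U atTop) (hg : ∀ᶠ g in U, c ^ σ g * r g = g) : x = e := by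
  have h1 : Tendsto (fun g => vertex f S (c ^ σ g)) U (𝓝 e) := he.comp hσ
  have h2 : Tendsto (vertex f S) U (𝓝 x) := (tendsto_vertex_trace x).mono_left hU
  refine tendsto_nhds_unique (tendsto_of_tendsto_of_dist h2 ?_) h1
  rw [Metric.tendsto_nhds]
  intro ε hε
  have h3 : ∀ s ∈ Set.range r, ∀ᶠ n in atTop, S.floydDist f (c ^ n) (c ^ n * s) < ε := fun s _ =>
    ((S.tendsto_floydDist_mul_right f s).comp (S.tendsto_pow_cofinite h)).eventually_lt_const hε
  filter_upwards [hg, hσ.eventually ((eventually_all_finite hr).2 h3)] with g hg hs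
  have h4 := hs (r g) ⟨g, rfl⟩
  rw [hg] at h4
  rw [dist_vertex, Real.dist_0_eq_abs, abs_of_nonneg (S.floydDist_nonneg f _ _),
    S.floydDist_comm]
  exact h4

/-- An infinite virtually cyclic group is quasi-isometric to a cyclic subgroup. -/
theorem exists_virtually_cyclic_data [Infinite G] (hG : IsElementary G) :
    ∃ (c : G) (k : G → ℤ) (r : G → G) (M : ℕ), 0 < M ∧ (Set.range r).Finite ∧
      (∀ g, c ^ k g * r g = g) ∧ ∀ n : ℤ, n.natAbs ≤ M * S.wordLength (c ^ n) := by
  obtain ⟨H, hcyc, hfin⟩ := hG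
  obtain ⟨⟨c, hcH⟩, hc⟩ := hcyc.exists_generator
  have hcH' : ∀ g ∈ H, ∃ k : ℤ, c ^ k = g := by
    intro g hg
    obtain ⟨k, hk⟩ := Subgroup.mem_zpowers_iff.1 (hc ⟨g, hg⟩)
    exact ⟨k, by simpa using congrArg Subtype.val hk⟩
  -- The inverses turn the left cosets of the quotient into right cosets `H * g`.
  set r : G → G := fun g => ((g⁻¹ : G) : G ⧸ H).out⁻¹ with hr
  have hrfin : (Set.range r).Finite := by
    refine (Set.finite_range fun q : G ⧸ H => q.out⁻¹).subset ?_
    rintro _ ⟨g, rfl⟩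
    exact ⟨_, rfl⟩
  have hk : ∀ g, ∃ k : ℤ, c ^ k * r g = g := by
    intro g
    have h1 : ((((g⁻¹ : G) : G ⧸ H).out : G) : G ⧸ H) = ((g⁻¹ : G) : G ⧸ H) := Quotient.out_eq' _
    have h2 := QuotientGroup.eq.1 h1.symm
    rw [inv_inv] at h2
    obtain ⟨k, hk⟩ := hcH' _ h2
    exact ⟨k, by simp [hk, hr]⟩
  choose k hk using hk
  have hinj : Function.Injective fun n : ℤ => c ^ n := by
    rw [injective_zpow_iff_not_isOfFinOrder]
    intro hfo
    have h1 : (H : Set G).Finite := hfo.finite_zpowers.subset fun g hg => by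
      obtain ⟨n, hn⟩ := hcH' g hg
      exact ⟨n, hn⟩
    have h2 := Set.Finite.image2 (fun a b => a * b) h1 hrfin
    refine Set.infinite_univ (α := G) (h2.subset fun g _ => ?_)
    exact ⟨c ^ k g, H.zpow_mem hcH _, r g, ⟨g, rfl⟩, hk g⟩
  -- Along an edge from `g` to `h`, `c ^ (k h - k g) = r g * (g⁻¹ * h) * (r h)⁻¹`, so the exponent
  -- changes by an element of this finite set.
  have hfinF : {n : ℤ | ∃ a ∈ Set.range r, ∃ s ∈ {s | S.wordLength s ≤ 1}, ∃ b ∈ Set.range r,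
      c ^ n = a * s * b⁻¹}.Finite := by
    have h1 := ((hrfin.image2 (fun a s => a * s) (S.finite_wordLength_le 1)).image2
      (fun a b => a * b⁻¹) hrfin).preimage hinj.injOn
    refine h1.subset ?_
    rintro n ⟨a, ha, s, hs, b, hb, h⟩
    exact ⟨a * s, ⟨a, ha, s, hs, rfl⟩, b, hb, h.symm⟩
  obtain ⟨M, hM⟩ := (hfinF.image Int.natAbs).bddAbove
  have hstep : ∀ g h, S.cayley.Adj g h → (k h - k g).natAbs ≤ M := by
    intro g h hadj
    refine hM ⟨_, ⟨r g, ⟨g, rfl⟩, g⁻¹ * h, (S.wordLength_inv_mul_of_adj hadj).le, r h, ⟨h, rfl⟩, ?_⟩,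
      rfl⟩
    have h1 : r g = (c ^ k g)⁻¹ * g := eq_inv_mul_of_mul_eq (hk g)
    have h2 : r h = (c ^ k h)⁻¹ * h := eq_inv_mul_of_mul_eq (hk h)
    rw [h1, h2, sub_eq_neg_add, zpow_add, zpow_neg]
    group
  have hlip : ∀ n g, S.wordLength g = n → (k g - k 1).natAbs ≤ M * n := by
    intro n
    induction n with
    | zero =>
      intro g hg
      rw [S.wordLength_eq_zero] at hg
      simp [hg]
    | succ n ih =>
      intro g hg
      have hne : g ≠ 1 := by
        rintro rfl
        simp at hg
      obtain ⟨h, hadj, hh⟩ := S.exists_adj_of_ne hne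
      rw [mul_one, mul_one, S.wordLength_inv, S.wordLength_inv] at hh
      have h1 := ih h (by omega)
      have h2 := hstep h g hadj.symm
      rw [mul_add, mul_one]
      omega
  refine ⟨c, k, r, M + 1, M.succ_pos, hrfin, hk, fun n => ?_⟩
  have hrn : r (c ^ n) = r 1 := by
    have h1 : (((c ^ n)⁻¹ : G) : G ⧸ H) = ((1⁻¹ : G) : G ⧸ H) := by
      rw [QuotientGroup.eq]
      simpa using H.zpow_mem hcH n
    simp only [hr, h1]
  have hkn : k (c ^ n) = n + k 1 := by
    apply hinj
    have h1 := hk (c ^ n)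
    have h2 := hk 1
    rw [hrn] at h1
    simp only [zpow_add]
    rw [eq_mul_inv_of_mul_eq h1, eq_mul_inv_of_mul_eq h2, one_mul]
  have := hlip _ (c ^ n) rfl
  rw [hkn, add_sub_cancel_right] at this
  exact this.trans (Nat.mul_le_mul_right _ M.le_succ)

/-- For infinite `G` the powers of `c` and of `c⁻¹` converge, and every boundary point is one of the
two limits. -/
theorem finite_compl_range_vertex (hG : IsElementary G) :
    (Set.range (vertex f S))ᶜ.Finite := by
  rcases finite_or_infinite G with hfin | hinf
  · have h : IsClosed (Set.range (vertex f S)) := (Set.finite_range _).isClosed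
    have : Set.range (vertex f S) = Set.univ := by
      rw [← h.closure_eq]
      exact denseRange_vertex.closure_range
    simp [this]
  obtain ⟨c, k, r, M, hM, hr, hk, hc⟩ := S.exists_virtually_cyclic_data hG
  have h1 : ∀ n : ℕ, n ≤ M * S.wordLength (c ^ n) := fun n => by simpa using hc n
  have h2 : ∀ n : ℕ, n ≤ M * S.wordLength (c⁻¹ ^ n) := fun n => by simpa using hc (-n)
  obtain ⟨e₁, he₁⟩ := cauchySeq_tendsto_of_complete (S.cauchySeq_vertex_pow f hM h1)
  obtain ⟨e₂, he₂⟩ := cauchySeq_tendsto_of_complete (S.cauchySeq_vertex_pow f hM h2)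
  refine (Set.toFinite {e₁, e₂}).subset fun x hx => ?_
  have hkc : Tendsto (fun g => (k g).natAbs) cofinite atTop := by
    rw [← Nat.cofinite_eq_atTop]
    refine Tendsto.cofinite_of_finite_preimage_singleton fun n => ?_
    have h3 : ({m : ℤ | m.natAbs = n}).Finite :=
      (Set.toFinite {(n : ℤ), -(n : ℤ)}).subset fun m hm => by
        have hm : m.natAbs = n := hm
        simp only [Set.mem_insert_iff, Set.mem_singleton_iff]
        omega
    exact ((h3.image2 (fun m s => c ^ m * s) hr)).subset fun g hg =>
      ⟨k g, hg, r g, ⟨g, rfl⟩, hk g⟩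
  -- An ultrafilter decides the sign of `k`, and thereby which limit is `x`.
  have hU : (Ultrafilter.of (trace x) : Filter G) ≤ trace x := Ultrafilter.of_le _
  have hkU : Tendsto (fun g => (k g).natAbs) (Ultrafilter.of (trace x) : Filter G) atTop :=
    hkc.mono_left (hU.trans (trace_le_cofinite hx))
  rcases (Ultrafilter.of (trace x)).eventually_or.1
    (Eventually.of_forall fun g => le_total 0 (k g)) with hpos | hneg
  · refine Or.inl (eq_of_tendsto_pow h1 he₁ hU hr hkU ?_)
    filter_upwards [hpos] with g hg
    rw [← zpow_natCast, Int.natAbs_of_nonneg hg, hk]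
  · refine Or.inr (eq_of_tendsto_pow h2 he₂ hU hr hkU ?_)
    filter_upwards [hneg] with g hg
    rw [← zpow_natCast, inv_zpow', Int.ofNat_natAbs_of_nonpos hg, neg_neg, hk]

theorem countable_completion (hG : IsElementary G) : Countable (FloydCompletion f S) := by
  have := S.countable_of_finite
  rw [← Set.countable_univ_iff, ← Set.union_compl_self (Set.range (vertex f S))]
  exact (Set.countable_range _).union (S.finite_compl_range_vertex f hG).countable

end GeneratingSet

/-! ### Syllables in free products. -/

namespace Monoid.CoprodI

variable {ι : Type*} {A : ι → Type*} [∀ i, Group (A i)]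

open Classical in
/-- The first syllable of `g` if it belongs to `A i`, and `1` otherwise. -/
noncomputable def firstSyllable (i : ι) (g : CoprodI A) : A i :=
  (Word.equivPair i (Word.equiv g)).head

open Classical in
theorem firstSyllable_of_mul (i : ι) (a : A i) (g : CoprodI A) :
    firstSyllable i (of a * g) = a * firstSyllable i g := by
  have h : Word.equiv (of a * g) = of a • Word.equiv g :=
    mul_smul (of a : CoprodI A) g (Word.empty : Word A)
  rw [firstSyllable, h, Word.equivPair_smul_same]
  rfl

@[simp]
theorem firstSyllable_one (i : ι) : firstSyllable i (1 : CoprodI A) = 1 := by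
  classical
  have h : Word.equiv (1 : CoprodI A) = Word.empty :=
    one_smul (CoprodI A) Word.empty
  rw [firstSyllable, h, Word.equivPair_head]
  simp [Word.empty]

@[simp]
theorem firstSyllable_of (i : ι) (a : A i) : firstSyllable i (of a) = a := by
  simpa using firstSyllable_of_mul i a 1

theorem firstSyllable_eq_one_of_ne {i k : ι} (hik : i ≠ k) {g : CoprodI A}
    (h : firstSyllable k g ≠ 1) : firstSyllable i g = 1 := by
  classical
  rw [firstSyllable, Word.equivPair_head] at h ⊢
  split_ifs at h with hk
  · refine dif_neg fun ⟨h1, h2⟩ => hik ?_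
    rw [← h2, ← hk.2]
  · exact absurd rfl h

theorem firstSyllable_of_ne {i k : ι} (hik : i ≠ k) (a : A k) :
    firstSyllable i (of a : CoprodI A) = 1 := by
  by_cases ha : a = 1
  · simp [ha]
  · exact firstSyllable_eq_one_of_ne hik (by simpa using ha)

theorem firstSyllable_induction {P : CoprodI A → Prop} (one : P 1)
    (mul : ∀ i (b : A i) t, b ≠ 1 → firstSyllable i t = 1 → P t → P (of b * t)) (g : CoprodI A) :
    P g := by
  classical
  suffices ∀ w : Word A, P w.prod by
    have h := this (Word.equiv g)
    rwa [show (Word.equiv g).prod = g from Word.equiv.symm_apply_apply g] at h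
  intro w
  induction w using Word.consRecOn with
  | empty => simpa using one
  | cons i m w h1 h2 ih =>
    rw [Word.prod_cons]
    refine mul i m _ h2 ?_ ih
    have h : Word.equiv w.prod = w := Word.equiv.apply_symm_apply w
    rw [firstSyllable, h, Word.equivPair_eq_of_fstIdx_ne h1]

theorem eq_one_of_firstSyllable {g : CoprodI A} (h : ∀ i, firstSyllable i g = 1) : g = 1 := by
  induction g using firstSyllable_induction with
  | one => rfl
  | mul i b t hb ht _ =>
    have := h i
    rw [firstSyllable_of_mul, ht, mul_one] at this
    exact absurd this hb

theorem eq_one_of_mem_range {i : ι} {g : CoprodI A} (h : firstSyllable i g = 1)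
    (hg : g ∈ (of : A i →* CoprodI A).range) : g = 1 := by
  obtain ⟨a, rfl⟩ := hg
  rw [firstSyllable_of] at h
  rw [h, map_one]

/-- Right multiplication acts at the end of a word and reaches the first syllable only if nothing
lies in between. Geometrically, the projection to `A i` moves only along edges inside `A i`. -/
theorem firstSyllable_mul_of (i : ι) {j : ι} (s : A j) (g : CoprodI A) :
    firstSyllable i (g * of s) = firstSyllable i g ∨
      i = j ∧ g ∈ (of : A i →* CoprodI A).range := by
  induction g using firstSyllable_induction generalizing i with
  | one =>
    by_cases hij : i = j
    · exact Or.inr ⟨hij, one_mem _⟩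
    · left
      rw [one_mul, firstSyllable_of_ne hij, firstSyllable_one]
  | mul k b t hb ht ih =>
    by_cases hik : i = k
    · subst hik
      rcases ih i with h | ⟨hj, h⟩
      · left
        rw [mul_assoc, firstSyllable_of_mul, firstSyllable_of_mul, h]
      · obtain rfl := eq_one_of_mem_range ht h
        exact Or.inr ⟨hj, by simp⟩
    · left
      have h1 : firstSyllable i (of b * t) = 1 := firstSyllable_eq_one_of_ne hik (by
        rwa [firstSyllable_of_mul, ht, mul_one])
      rw [h1, mul_assoc]
      rcases ih k with h | ⟨rfl, h⟩
      · exact firstSyllable_eq_one_of_ne hik (by rwa [firstSyllable_of_mul, h, ht, mul_one])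
      · obtain rfl := eq_one_of_mem_range ht h
        rw [one_mul, ← map_mul]
        exact firstSyllable_of_ne hik _

/-- The sum of the lengths of the syllables of an element. -/
noncomputable def syllableSum (ℓ : ∀ i, A i → ℕ) (g : CoprodI A) : ℕ := by
  classical exact ((Word.equiv g).toList.map fun p => ℓ p.1 p.2).sum

variable (ℓ : ∀ i, A i → ℕ)

theorem syllableSum_one : syllableSum ℓ (1 : CoprodI A) = 0 := by
  classical
  have h : Word.equiv (1 : CoprodI A) = Word.empty :=
    one_smul (CoprodI A) Word.empty
  rw [syllableSum, h]
  rfl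

theorem syllableSum_of_mul (hℓ : ∀ i, ℓ i 1 = 0) {i : ι} (a : A i) {t : CoprodI A}
    (ht : firstSyllable i t = 1) : syllableSum ℓ (of a * t) = ℓ i a + syllableSum ℓ t := by
  classical
  have h : Word.equiv (of a * t) = of a • Word.equiv t :=
    mul_smul (of a : CoprodI A) t (Word.empty : Word A)
  have h1 : (Word.equivPair i (Word.equiv t)).tail = Word.equiv t := by
    have := Word.equivPair_head_smul_equivPair_tail (i := i) (Word.equiv t)
    rw [firstSyllable] at ht
    rwa [ht, map_one, one_smul] at this
  rw [syllableSum, syllableSum, h, Word.of_smul_def]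
  rw [firstSyllable] at ht
  by_cases ha : a = 1
  · subst ha
    simp [Word.rcons, ht, h1, hℓ]
  · simp [Word.rcons, ht, h1, ha]

end Monoid.CoprodI

/-! ### The Floyd metric of a free product. -/

namespace GeneratingSet

open Monoid.CoprodI Filter Topology
open Monoid (CoprodI)

section

variable {n : ℕ} {A : Fin n → Type u} [∀ i, Group (A i)] (S : ∀ i, GeneratingSet (A i))
  (f : FloydFunction)

theorem cayley_adj_freeProduct {g h : CoprodI A} :
    (freeProduct S).cayley.Adj g h ↔
      g ≠ h ∧ ∃ i, ∃ s ∈ (S i).carrier, g * of s = h ∨ g = h * of s := by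
  rw [cayley_adj]
  simp only [freeProduct, Set.mem_iUnion, Set.mem_image]
  grind

theorem cayley_adj_of {i : Fin n} {a b : A i} (h : (S i).cayley.Adj a b) :
    (freeProduct S).cayley.Adj (of a) (of b) := by
  obtain ⟨hne, s, hs, h1⟩ := (S i).cayley_adj.1 h
  refine (cayley_adj_freeProduct S).2 ⟨(of_injective i).ne hne, i, s, hs, ?_⟩
  simp only [← map_mul, (of_injective i).eq_iff]
  exact h1

theorem wordLength_of_le {i : Fin n} (a : A i) :
    (freeProduct S).wordLength (of a) ≤ (S i).wordLength a := by
  obtain ⟨p, hp⟩ := (S i).cayley_connected.exists_walk_length_eq_dist 1 a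
  rw [wordLength, wordLength, ← hp, ← SimpleGraph.Walk.length_map
    (f := (⟨fun a => of a, fun h => cayley_adj_of S h⟩ :
      (S i).cayley →g (freeProduct S).cayley)) (p := p), ← map_one (of (i := i))]
  exact SimpleGraph.dist_le _

/-- For the lower bound, left multiplication by `s` in a factor raises the syllable sum by at most
the length of `s`; a geodesic is then peeled off from its first edge. -/
theorem wordLength_eq_syllableSum (g : CoprodI A) :
    (freeProduct S).wordLength g = syllableSum (fun i => (S i).wordLength) g := by
  have hone : ∀ i, (S i).wordLength 1 = 0 := fun i => (S i).wordLength_one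
  apply le_antisymm
  · induction g using firstSyllable_induction with
    | one => simp
    | mul i b t hb ht ih =>
      rw [syllableSum_of_mul _ hone b ht]
      exact ((freeProduct S).wordLength_mul_le _ _).trans
        (add_le_add (wordLength_of_le S b) ih)
  · have key : ∀ i (s : A i) (g : CoprodI A), syllableSum (fun i => (S i).wordLength) (of s * g) ≤
        (S i).wordLength s + syllableSum (fun i => (S i).wordLength) g := by
      intro i s g
      obtain ⟨t, ht, hg⟩ : ∃ t, firstSyllable i t = 1 ∧ g = of (firstSyllable i g) * t :=
        ⟨of (firstSyllable i g)⁻¹ * g, by rw [firstSyllable_of_mul, inv_mul_cancel],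
          by rw [← mul_assoc, ← map_mul, mul_inv_cancel, map_one, one_mul]⟩
      rw [hg, ← mul_assoc, ← map_mul, syllableSum_of_mul _ hone _ ht,
        syllableSum_of_mul _ hone _ ht, ← add_assoc]
      exact Nat.add_le_add_right ((S i).wordLength_mul_le _ _) _
    obtain ⟨m, hm⟩ : ∃ m, (freeProduct S).wordLength g = m := ⟨_, rfl⟩
    rw [hm]
    induction m generalizing g with
    | zero =>
      rw [wordLength_eq_zero] at hm
      rw [hm, syllableSum_one]
    | succ m ih =>
      have hne : 1 ≠ g := by
        rintro rfl
        simp at hm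
      obtain ⟨h, hadj, hh⟩ := (freeProduct S).exists_adj_of_ne hne
      rw [inv_one, one_mul, hm, add_left_inj] at hh
      obtain ⟨hne1, i, s, hs, hs'⟩ := (cayley_adj_freeProduct S).1 hadj
      obtain ⟨x, rfl, hx⟩ : ∃ x : A i, h = of x ∧ (S i).cayley.Adj 1 x := by
        rcases hs' with hs' | hs'
        · rw [one_mul] at hs'
          subst hs'
          refine ⟨s, rfl, (S i).cayley_adj.2 ⟨?_, s, hs, Or.inl (one_mul s)⟩⟩
          rintro rfl
          simp at hne1
        · obtain rfl := eq_inv_of_mul_eq_one_left hs'.symm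
          refine ⟨s⁻¹, (map_inv _ _).symm, (S i).cayley_adj.2 ⟨?_, s, hs, Or.inr (by simp)⟩⟩
          intro hs1
          rw [← map_inv, ← hs1, map_one] at hne1
          exact hne1 rfl
      have h1 := ih _ hh
      have h2 := key i x ((of x)⁻¹ * g)
      have h3 := (S i).wordLength_le_of_adj hx
      rw [mul_inv_cancel_left] at h2
      rw [wordLength_one] at h3
      omega

theorem wordLength_of_mul {i : Fin n} (a : A i) {t : CoprodI A} (ht : firstSyllable i t = 1) :
    (freeProduct S).wordLength (of a * t) =
      (S i).wordLength a + (freeProduct S).wordLength t := by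
  simp only [wordLength_eq_syllableSum]
  exact syllableSum_of_mul _ (fun i => (S i).wordLength_one) a ht

@[simp]
theorem wordLength_of {i : Fin n} (a : A i) :
    (freeProduct S).wordLength (of a) = (S i).wordLength a := by
  simpa using wordLength_of_mul S a (firstSyllable_one i)

theorem floydDist_of_le {i : Fin n} (a b : A i) :
    (freeProduct S).floydDist f (of a) (of b) ≤ (S i).floydDist f a b := by
  rw [← one_mul ((S i).floydDist f a b)]
  refine (S i).floydDist_map_le f _ f (fun a => of a) zero_le_one (fun a b hab => ?_) a b
  refine ((freeProduct S).floydDist_le_edgeLength f (cayley_adj_of S hab)).trans ?_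
  rw [one_mul, edgeLength, edgeLength, wordLength_of, wordLength_of]

/-- An edge is either collapsed or lies in `A i`, where the word lengths of the factor and of the
product agree. -/
theorem floydDist_firstSyllable_le (i : Fin n) (g h : CoprodI A) :
    (S i).floydDist f (firstSyllable i g) (firstSyllable i h) ≤
      (freeProduct S).floydDist f g h := by
  rw [← one_mul ((freeProduct S).floydDist f g h)]
  refine (freeProduct S).floydDist_map_le f _ f (firstSyllable i) zero_le_one ?_ g h
  have key : ∀ (g : CoprodI A) (j : Fin n), ∀ s ∈ (S j).carrier, g ≠ g * of s →
      (S i).floydDist f (firstSyllable i g) (firstSyllable i (g * of s)) ≤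
        (freeProduct S).edgeLength f g (g * of s) := by
    intro g j s hs hne
    rcases firstSyllable_mul_of i s g with h | ⟨rfl, a, rfl⟩
    · rw [h, floydDist_self]
      exact (f.pos _).le
    · rw [← map_mul] at hne ⊢
      rw [firstSyllable_of, firstSyllable_of, edgeLength, wordLength_of, wordLength_of]
      exact (S i).floydDist_le_edgeLength f ((S i).cayley_adj.2
        ⟨fun h => hne (congrArg _ h), s, hs, Or.inl rfl⟩)
  intro g h hadj
  obtain ⟨hne, j, s, hs, rfl | rfl⟩ := (cayley_adj_freeProduct S).1 hadj
  · rw [one_mul]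
    exact key g j s hs hne
  · rw [one_mul, floydDist_comm, edgeLength_comm]
    exact key h j s hs hne.symm

/-- Two elements branch off at a coset `w * A i`, which lies on the geodesics from the identity to
both elements. -/
theorem exists_branch {u v : CoprodI A} (huv : u ≠ v) :
    ∃ (i : Fin n) (w : CoprodI A), firstSyllable i w⁻¹ = 1 ∧
      firstSyllable i (w⁻¹ * u) ≠ firstSyllable i (w⁻¹ * v) ∧
      (freeProduct S).wordLength u =
        (freeProduct S).wordLength w + (freeProduct S).wordLength (w⁻¹ * u) ∧
      (freeProduct S).wordLength v =
        (freeProduct S).wordLength w + (freeProduct S).wordLength (w⁻¹ * v) := by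
  induction u using firstSyllable_induction generalizing v with
  | one =>
    obtain ⟨i, hi⟩ := not_forall.1 fun h => huv (eq_one_of_firstSyllable h).symm
    exact ⟨i, 1, by simp, by simpa using Ne.symm hi, by simp, by simp⟩
  | mul k b t hb ht ih =>
    by_cases hv : firstSyllable k v = b
    · obtain ⟨v, rfl⟩ : ∃ v', v = of b * v' := ⟨(of b)⁻¹ * v, by simp⟩
      rw [firstSyllable_of_mul, mul_eq_left] at hv
      obtain ⟨i, w, h1, h2, h3, h4⟩ := ih (v := v) (by rintro rfl; exact huv rfl)
      have hgeo : ∀ x : CoprodI A, firstSyllable k x = 1 → (freeProduct S).wordLength x =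
          (freeProduct S).wordLength w + (freeProduct S).wordLength (w⁻¹ * x) →
          (freeProduct S).wordLength (of b * x) = (freeProduct S).wordLength (of b * w) +
            (freeProduct S).wordLength ((of b * w)⁻¹ * (of b * x)) := by
        intro x hx hxw
        have e : (of b * w)⁻¹ * (of b * x) = w⁻¹ * x := by group
        have a1 := (freeProduct S).wordLength_mul_le (of b * w) (w⁻¹ * x)
        have a2 := (freeProduct S).wordLength_mul_le (of b) w
        have a3 := wordLength_of_mul S b hx
        rw [wordLength_of] at a2
        rw [mul_assoc, mul_inv_cancel_left] at a1
        rw [e]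
        omega
      refine ⟨i, of b * w, ?_, by simpa [mul_assoc] using h2, hgeo t ht h3, hgeo v hv h4⟩
      rw [mul_inv_rev, ← map_inv]
      -- Minimality of `of b * w` in its coset could fail only for `i = k` and `w = 1`, but then
      -- both syllables in `h2` would be trivial.
      rcases firstSyllable_mul_of i b⁻¹ w⁻¹ with h | ⟨rfl, h⟩
      · rw [h, h1]
      · have hw := eq_one_of_mem_range h1 h
        rw [hw, one_mul, one_mul, ht, hv] at h2
        exact absurd rfl h2
    · refine ⟨k, 1, by simp, ?_, by simp, by simp⟩
      rw [inv_one, one_mul, one_mul, firstSyllable_of_mul, ht, mul_one]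
      exact Ne.symm hv

end

end GeneratingSet

/-! ### Boundaries of cosets as a null family. -/

namespace FloydCompletion

open Monoid.CoprodI Filter Topology GeneratingSet
open Monoid (CoprodI)

/-- The complement of the vertices in the Floyd completion, with the subspace metric. -/
abbrev Boundary {G : Type u} [Group G] (f : FloydFunction) (S : GeneratingSet G) : Type u :=
  {x : FloydCompletion f S // x ∉ Set.range (vertex f S)}

instance {G : Type u} [Group G] (f : FloydFunction) (S : GeneratingSet G) :
    CompactSpace (Boundary f S) :=
  isCompact_iff_compactSpace.1 (isOpen_range_vertex f S).isClosed_compl.isCompact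

variable {n : ℕ} {A : Fin n → Type u} [∀ i, Group (A i)]

section

variable (f : FloydFunction) (S : ∀ i, GeneratingSet (A i))

/-- The map of Floyd completions induced by the inclusion of the coset `w * A i`. -/
noncomputable def incl (i : Fin n) (w : CoprodI A) :
    FloydCompletion f (S i) → FloydCompletion f (freeProduct S) :=
  map f (S i) f (freeProduct S) fun a => w * of a

/-- The map of Floyd completions induced by the projection to the coset `w * A i`. -/
noncomputable def proj (i : Fin n) (w : CoprodI A) :
    FloydCompletion f (freeProduct S) → FloydCompletion f (S i) :=
  map f (freeProduct S) f (S i) fun x => firstSyllable i (w⁻¹ * x)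

variable {f S} {i j : Fin n}

theorem continuous_incl (w : CoprodI A) : Continuous (incl f S i w) := continuous_map _

theorem continuous_proj (w : CoprodI A) : Continuous (proj f S i w) := continuous_map _

theorem incl_vertex (w : CoprodI A) (a : A i) :
    incl f S i w (vertex f (S i) a) = vertex f (freeProduct S) (w * of a) := by
  obtain ⟨K, hK, h⟩ := (freeProduct S).exists_floydDist_mul_left_le f w
  exact map_vertex ⟨K, hK, fun a b => (h _ _).trans
    (mul_le_mul_of_nonneg_left (floydDist_of_le S f a b) hK)⟩ a

theorem proj_vertex (w x : CoprodI A) :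
    proj f S i w (vertex f (freeProduct S) x) = vertex f (S i) (firstSyllable i (w⁻¹ * x)) := by
  obtain ⟨K, hK, h⟩ := (freeProduct S).exists_floydDist_mul_left_le f w⁻¹
  exact map_vertex ⟨K, hK, fun a b => (floydDist_firstSyllable_le S f i _ _).trans (h _ _)⟩ x

theorem proj_incl (w : CoprodI A) (b : FloydCompletion f (S i)) :
    proj f S i w (incl f S i w b) = b :=
  eq_of_forall_vertex ((continuous_proj w).comp (continuous_incl w)) continuous_id
    (fun a => by simp [incl_vertex, proj_vertex]) b

theorem incl_notMem_range (w : CoprodI A) {b : FloydCompletion f (S i)}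
    (hb : b ∉ Set.range (vertex f (S i))) :
    incl f S i w b ∉ Set.range (vertex f (freeProduct S)) := by
  rintro ⟨g, hg⟩
  refine hb ⟨firstSyllable i (w⁻¹ * g), ?_⟩
  rw [← proj_vertex, hg, proj_incl]

theorem floydDist_firstSyllable_self_le (i : Fin n) (x : CoprodI A) :
    (freeProduct S).floydDist f (of (firstSyllable i x)) x ≤
      f.tail ((S i).wordLength (firstSyllable i x)) := by
  rw [← wordLength_of S]
  refine (freeProduct S).floydDist_le_tail f ?_
  rw [wordLength_of, ← wordLength_of_mul, mul_inv_cancel_left]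
  rw [← map_inv, firstSyllable_of_mul, inv_mul_cancel]

/-- As vertices `g` tend to `x`, their projections leave every finite set, so the distance from `g`
to its projection, bounded by a multiple of a tail, tends to zero. -/
theorem incl_proj (w : CoprodI A) {x : FloydCompletion f (freeProduct S)}
    (hx : proj f S i w x ∉ Set.range (vertex f (S i))) : incl f S i w (proj f S i w x) = x := by
  have h1 : Tendsto (fun g => incl f S i w (proj f S i w (vertex f (freeProduct S) g))) (trace x)
      (𝓝 (incl f S i w (proj f S i w x))) :=
    (((continuous_incl w).comp (continuous_proj w)).tendsto x).comp (tendsto_vertex_trace x)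
  refine tendsto_nhds_unique h1 (tendsto_of_tendsto_of_dist (tendsto_vertex_trace x) ?_)
  obtain ⟨K, hK, h⟩ := (freeProduct S).exists_floydDist_mul_left_le f w
  have h2 : Tendsto (fun g => firstSyllable i (w⁻¹ * g)) (trace x) cofinite := by
    refine Tendsto.mono_right ?_ (trace_le_cofinite hx)
    refine tendsto_comap_iff.2 ?_
    have := ((continuous_proj (i := i) w).tendsto x).comp (tendsto_vertex_trace x)
    simpa only [Function.comp_def, proj_vertex] using this
  have h3 := ((f.tendsto_tail.comp (S i).tendsto_wordLength).comp h2).const_mul K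
  rw [mul_zero] at h3
  refine squeeze_zero (fun _ => dist_nonneg) (fun g => ?_) h3
  rw [proj_vertex, incl_vertex, dist_vertex, floydDist_comm]
  calc _ = (freeProduct S).floydDist f (w * of (firstSyllable i (w⁻¹ * g))) (w * (w⁻¹ * g)) := by
        rw [mul_inv_cancel_left]
    _ ≤ _ := (h _ _).trans (mul_le_mul_of_nonneg_left (floydDist_firstSyllable_self_le i _) hK)

/-- By `hw`, `w` is the shortest element of its coset and lies on geodesics from the identity to all
other elements. -/
theorem dist_incl_vertex_le {w : CoprodI A} (hw : firstSyllable i w⁻¹ = 1)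
    (b : FloydCompletion f (S i)) :
    dist (incl f S i w b) (vertex f (freeProduct S) w) ≤
      f.tail ((freeProduct S).wordLength w) := by
  refine isClosed_property denseRange_vertex
    (isClosed_le ((continuous_incl w).dist continuous_const) continuous_const) (fun a => ?_) b
  rw [incl_vertex, dist_vertex, floydDist_comm]
  refine (freeProduct S).floydDist_le_tail f ?_
  rw [inv_mul_cancel_left, wordLength_of, ← wordLength_inv, mul_inv_rev, ← map_inv,
    wordLength_of_mul S _ hw, wordLength_inv, wordLength_inv, add_comm]

/-- The projection could vary only if `i = j` and `w⁻¹ * w'` belonged to `A i`; the two cosets would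
then coincide, and so would their shortest elements. -/
theorem proj_incl_of_ne {w w' : CoprodI A} (hw : firstSyllable i w⁻¹ = 1)
    (hw' : firstSyllable j w'⁻¹ = 1) (hne : (i, w) ≠ (j, w')) (b : FloydCompletion f (S j)) :
    proj f S i w (incl f S j w' b) = vertex f (S i) (firstSyllable i (w⁻¹ * w')) := by
  refine eq_of_forall_vertex ((continuous_proj w).comp (continuous_incl w')) continuous_const
    (fun a => ?_) b
  rw [Function.comp_apply, incl_vertex, proj_vertex, ← mul_assoc]
  rcases firstSyllable_mul_of i a (w⁻¹ * w') with h | ⟨rfl, x, hx⟩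
  · rw [h]
  · have h1 : w'⁻¹ = of x⁻¹ * w⁻¹ := by
      rw [map_inv, hx]
      group
    rw [h1, firstSyllable_of_mul, hw, mul_one, inv_eq_one] at hw'
    subst hw'
    rw [map_one] at hx
    exact absurd (congrArg _ (inv_mul_eq_one.1 hx.symm)) hne

end

section

variable (A) in
/-- The cosets of the non-elementary factors, represented by their shortest elements. -/
abbrev CosetIndex : Type u :=
  {q : Fin n × CoprodI A // ¬ IsElementary (A q.1) ∧ firstSyllable q.1 q.2⁻¹ = 1}

variable (f : FloydFunction) (S : ∀ i, GeneratingSet (A i))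

/-- The Floyd boundary of a coset of a free factor, inside the boundary of the free product. -/
def cosetBoundary (q : CosetIndex A) : Set (Boundary f (freeProduct S)) :=
  {z | proj f S q.1.1 q.1.2 z.1 ∉ Set.range (vertex f (S q.1.1))}

variable {f S} in
theorem proj_incl_notMem_range {i : Fin n} (w : CoprodI A) {b : FloydCompletion f (S i)}
    (hb : b ∉ Set.range (vertex f (S i))) :
    proj f S i w (incl f S i w b) ∉ Set.range (vertex f (S i)) := by
  rwa [proj_incl]

/-- The boundary of a coset is homeomorphic to the boundary of the factor. -/
noncomputable def cosetBoundaryHomeomorph (q : CosetIndex A) :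
    cosetBoundary f S q ≃ₜ Boundary f (S q.1.1) where
  toFun z := ⟨proj f S q.1.1 q.1.2 z.1.1, z.2⟩
  invFun b := ⟨⟨incl f S q.1.1 q.1.2 b.1, incl_notMem_range _ b.2⟩,
    proj_incl_notMem_range q.1.2 b.2⟩
  left_inv z := Subtype.ext (Subtype.ext (incl_proj _ z.2))
  right_inv _ := Subtype.ext (proj_incl _ _)
  continuous_toFun := ((continuous_proj _).comp
    (continuous_subtype_val.comp continuous_subtype_val)).subtype_mk _
  continuous_invFun := (((continuous_incl _).comp continuous_subtype_val).subtype_mk _).subtype_mk _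

variable {f S}

theorem infinite_of_not_isElementary {G : Type*} [Group G] (h : ¬ IsElementary G) : Infinite G := by
  by_contra hfin
  rw [not_infinite_iff_finite] at hfin
  exact h ⟨⊥, inferInstance, inferInstance⟩

theorem cosetBoundary_nonempty (q : CosetIndex A) : (cosetBoundary f S q).Nonempty := by
  have := infinite_of_not_isElementary q.2.1
  obtain ⟨b, hb⟩ := exists_notMem_range_vertex f (S q.1.1)
  exact ⟨_, ((cosetBoundaryHomeomorph f S q).symm ⟨b, hb⟩).2⟩

theorem isClosed_cosetBoundary (q : CosetIndex A) : IsClosed (cosetBoundary f S q) :=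
  (isOpen_range_vertex f (S q.1.1)).isClosed_compl.preimage
    ((continuous_proj _).comp continuous_subtype_val)

theorem dist_vertex_le_of_mem {q : CosetIndex A} {z : Boundary f (freeProduct S)}
    (hz : z ∈ cosetBoundary f S q) :
    dist z.1 (vertex f (freeProduct S) q.1.2) ≤ f.tail ((freeProduct S).wordLength q.1.2) := by
  rw [← incl_proj (i := q.1.1) q.1.2 hz]
  exact dist_incl_vertex_le q.2.2 _

theorem proj_eq_vertex_of_mem {w : CoprodI A} {i : Fin n} (hw : firstSyllable i w⁻¹ = 1)
    {q : CosetIndex A} (hq : (i, w) ≠ q.1) {z : Boundary f (freeProduct S)}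
    (hz : z ∈ cosetBoundary f S q) :
    proj f S i w z.1 = vertex f (S i) (firstSyllable i (w⁻¹ * q.1.2)) := by
  rw [← incl_proj (i := q.1.1) q.1.2 hz]
  exact proj_incl_of_ne hw q.2.2 hq _

theorem eq_of_mem_cosetBoundary {q q' : CosetIndex A} {z : Boundary f (freeProduct S)}
    (hz : z ∈ cosetBoundary f S q) (hz' : z ∈ cosetBoundary f S q') : q = q' := by
  by_contra hne
  exact hz ⟨_, (proj_eq_vertex_of_mem q.2.2 (fun h => hne (Subtype.ext h)) hz').symm⟩

theorem finite_le_diam_cosetBoundary {ε : ℝ} (hε : 0 < ε) :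
    {q | ε ≤ Metric.diam (cosetBoundary f S q)}.Finite := by
  obtain ⟨N, hN⟩ := (f.tendsto_tail.eventually_lt_const (half_pos hε)).exists
  refine Set.Finite.subset (((Set.finite_univ (α := Fin n)).prod
    ((freeProduct S).finite_wordLength_le N)).preimage Subtype.val_injective.injOn) fun q hq => ?_
  refine ⟨Set.mem_univ _, show _ ≤ N from le_of_not_gt fun hlt => ?_⟩
  have h1 : f.tail ((freeProduct S).wordLength q.1.2) < ε / 2 :=
    (f.tail_antitone hlt.le).trans_lt hN
  have h2 : Metric.diam (cosetBoundary f S q) ≤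
      2 * f.tail ((freeProduct S).wordLength q.1.2) := by
    have h0 : 0 ≤ f.tail ((freeProduct S).wordLength q.1.2) :=
      tsum_nonneg fun k => (f.pos _).le
    refine Metric.diam_le_of_forall_dist_le (by positivity) fun z hz z' hz' => ?_
    rw [Subtype.dist_eq]
    have := dist_triangle_right z.1 z'.1 (vertex f (freeProduct S) q.1.2)
    linarith [dist_vertex_le_of_mem hz, dist_vertex_le_of_mem hz']
  have h3 : ε ≤ Metric.diam (cosetBoundary f S q) := hq
  linarith

/-- A vertex `g` near `x` is shortest in `g * A i` unless its last syllable belongs to `A i`. In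
that case a syllable `b` from another factor is appended, which moves `g` only slightly. -/
theorem exists_coset_close (hn : 2 ≤ n) [∀ i, Nontrivial (A i)] (i : Fin n)
    {x : FloydCompletion f (freeProduct S)} (hx : x ∉ Set.range (vertex f (freeProduct S)))
    {r : ℝ} (hr : 0 < r) (N : ℕ) :
    ∃ w : CoprodI A, firstSyllable i w⁻¹ = 1 ∧ N ≤ (freeProduct S).wordLength w ∧
      dist (vertex f (freeProduct S) w) x + f.tail ((freeProduct S).wordLength w) < r := by
  have : Nontrivial (Fin n) := Fin.nontrivial_iff_two_le.2 hn
  obtain ⟨j, hj⟩ := exists_ne i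
  obtain ⟨b, hb⟩ := exists_ne (1 : A j)
  obtain ⟨N₀, hN₀⟩ := (f.tendsto_tail.eventually_lt_const (show 0 < r / 3 by positivity)).exists
  have h1 : ∀ᶠ g in trace x, dist (vertex f (freeProduct S) g) x < r / 3 :=
    (tendsto_vertex_trace x).eventually (Metric.ball_mem_nhds x (by positivity))
  have h2 : ∀ᶠ g in trace x, (freeProduct S).floydDist f g (g * of b) < r / 3 :=
    (((freeProduct S).tendsto_floydDist_mul_right f (of b)).mono_left
      (trace_le_cofinite hx)).eventually_lt_const (by positivity)
  have h3 : ∀ᶠ g in trace x, N + N₀ + (S j).wordLength b ≤ (freeProduct S).wordLength g :=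
    ((freeProduct S).tendsto_wordLength.mono_left (trace_le_cofinite hx)).eventually_ge_atTop _
  obtain ⟨g, hg1, hg2, hg3⟩ := (h1.and (h2.and h3)).exists
  have key : ∀ w, N + N₀ ≤ (freeProduct S).wordLength w → firstSyllable i w⁻¹ = 1 →
      (freeProduct S).floydDist f g w < r / 3 → ∃ w : CoprodI A, firstSyllable i w⁻¹ = 1 ∧
        N ≤ (freeProduct S).wordLength w ∧
        dist (vertex f (freeProduct S) w) x + f.tail ((freeProduct S).wordLength w) < r := by
    intro w hwN hw hgw
    refine ⟨w, hw, by omega, ?_⟩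
    have h4 := dist_triangle_left (vertex f (freeProduct S) w) x (vertex f (freeProduct S) g)
    have h5 := f.tail_antitone (show N₀ ≤ (freeProduct S).wordLength w by omega)
    rw [dist_vertex] at h4
    linarith
  by_cases hgi : firstSyllable i g⁻¹ = 1
  · exact key g (by omega) hgi (by rw [floydDist_self]; positivity)
  · have h4 := (freeProduct S).wordLength_mul_le (g * of b) (of b)⁻¹
    rw [mul_inv_cancel_right, wordLength_inv, wordLength_of] at h4
    refine key (g * of b) (by omega) ?_ hg2
    refine firstSyllable_eq_one_of_ne hj.symm ?_
    rw [mul_inv_rev, ← map_inv, firstSyllable_of_mul, firstSyllable_eq_one_of_ne hj hgi, mul_one]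
    exact inv_ne_one.2 hb

theorem exists_cosetBoundary_subset_ball (hn : 2 ≤ n) [∀ i, Nontrivial (A i)] {i : Fin n}
    (hi : ¬ IsElementary (A i)) (z : Boundary f (freeProduct S)) {r : ℝ} (hr : 0 < r) (N : ℕ) :
    ∃ q : CosetIndex A, q.1.1 = i ∧ N ≤ (freeProduct S).wordLength q.1.2 ∧
      cosetBoundary f S q ⊆ Metric.ball z r := by
  obtain ⟨w, hw, hN, hd⟩ := exists_coset_close hn i z.2 hr N
  refine ⟨⟨(i, w), hi, hw⟩, rfl, hN, fun z' hz' => ?_⟩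
  rw [Metric.mem_ball, Subtype.dist_eq]
  have h1 := dist_vertex_le_of_mem hz'
  have h2 := dist_triangle z'.1 (vertex f (freeProduct S) w) z.1
  simp only at h1
  linarith

/-- Every ball contains the boundary of a coset with a longer representative, and distinct coset
boundaries are disjoint. -/
theorem interior_cosetBoundary (hn : 2 ≤ n) [∀ i, Nontrivial (A i)] (q : CosetIndex A) :
    interior (cosetBoundary f S q) = ∅ := by
  refine Set.eq_empty_of_forall_notMem fun z hz => ?_
  obtain ⟨r, hr, hball⟩ := Metric.isOpen_iff.1 isOpen_interior z hz
  obtain ⟨q', -, hN, hq'⟩ := exists_cosetBoundary_subset_ball hn q.2.1 z hr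
    ((freeProduct S).wordLength q.1.2 + 1)
  obtain ⟨z', hz'⟩ := cosetBoundary_nonempty (f := f) (S := S) q'
  have := eq_of_mem_cosetBoundary hz' (interior_subset (hball (hq' hz')))
  rw [this] at hN
  omega

/-- The boundary of any other coset projects to a single vertex. The boundary of `w * A i` itself is
missed when `K` consists of vertices and is not in the family when `A i` is elementary. -/
theorem isSaturatedClopen_preimage_proj {i : Fin n} {w : CoprodI A} (hw : firstSyllable i w⁻¹ = 1)
    {K : Set (FloydCompletion f (S i))} (hK : IsClopen K)
    (hKi : IsElementary (A i) ∨ K ⊆ Set.range (vertex f (S i))) :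
    IsSaturatedClopen (cosetBoundary f S)
      {z : Boundary f (freeProduct S) | proj f S i w z.1 ∈ K} := by
  refine ⟨hK.preimage ((continuous_proj w).comp continuous_subtype_val), fun q => ?_⟩
  by_cases hq : (i, w) = q.1
  · right
    refine Set.disjoint_left.2 fun z hz hzK => ?_
    obtain ⟨⟨i, w⟩, hq1⟩ := q
    obtain ⟨rfl, rfl⟩ := Prod.mk.inj hq
    exact hz (hKi.resolve_left hq1.1 hzK)
  · by_cases hv : vertex f (S i) (firstSyllable i (w⁻¹ * q.1.2)) ∈ K
    · left
      intro z hz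
      change proj f S i w z.1 ∈ K
      rwa [proj_eq_vertex_of_mem hw hq hz]
    · right
      refine Set.disjoint_left.2 fun z hz hzK => hv ?_
      rw [← proj_eq_vertex_of_mem hw hq hz]
      exact hzK

/-- Vertices close to `x` and `y` eventually have equal projections to the finitely many cosets with
representative of length at most `N`. They therefore branch off at a longer `w`, and both are within
`f.tail N` of it. -/
theorem eq_of_proj_eq_vertex {x y : FloydCompletion f (freeProduct S)}
    (h : ∀ (i : Fin n) (w : CoprodI A), firstSyllable i w⁻¹ = 1 →
      ∃ a, proj f S i w x = vertex f (S i) a ∧ proj f S i w y = vertex f (S i) a) : x = y := by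
  refine dist_le_zero.1 (le_of_forall_pos_le_add fun ε hε => ?_)
  rw [zero_add]
  obtain ⟨N, hN⟩ := (f.tendsto_tail.eventually_lt_const (half_pos hε)).exists
  have hev : ∀ (z : FloydCompletion f (freeProduct S)) (i : Fin n) (w : CoprodI A) (a : A i),
      proj f S i w z = vertex f (S i) a → ∀ᶠ u in trace z, firstSyllable i (w⁻¹ * u) = a := by
    intro z i w a ha
    have h1 := ((continuous_proj (i := i) w).tendsto z).comp (tendsto_vertex_trace z)
    rw [ha] at h1
    filter_upwards [h1.eventually ((isOpen_singleton_vertex a).mem_nhds rfl)] with u hu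
    have hu : proj f S i w (vertex f (freeProduct S) u) = vertex f (S i) a := hu
    rw [proj_vertex] at hu
    exact vertex_injective hu
  have h1 : ∀ᶠ p in trace x ×ˢ trace y, ∀ q ∈ (Set.univ : Set (Fin n)) ×ˢ
      {w | (freeProduct S).wordLength w ≤ N}, firstSyllable q.1 q.2⁻¹ = 1 →
      firstSyllable q.1 (q.2⁻¹ * p.1) = firstSyllable q.1 (q.2⁻¹ * p.2) := by
    refine (eventually_all_finite
      (Set.finite_univ.prod ((freeProduct S).finite_wordLength_le N))).2 fun q _ => ?_
    by_cases hq : firstSyllable q.1 q.2⁻¹ = 1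
    · obtain ⟨a, hxa, hya⟩ := h q.1 q.2 hq
      filter_upwards [(hev x q.1 q.2 a hxa).prod_mk (hev y q.1 q.2 a hya)] with p hp _
      rw [hp.1, hp.2]
    · exact Eventually.of_forall fun _ h => absurd h hq
  have h2 : Tendsto (fun p : CoprodI A × CoprodI A =>
      dist (vertex f (freeProduct S) p.1) (vertex f (freeProduct S) p.2)) (trace x ×ˢ trace y)
      (𝓝 (dist x y)) :=
    ((tendsto_vertex_trace x).comp tendsto_fst).dist ((tendsto_vertex_trace y).comp tendsto_snd)
  refine le_of_tendsto h2 ?_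
  filter_upwards [h1] with p hp
  rw [dist_vertex]
  by_cases hne : p.1 = p.2
  · rw [hne, floydDist_self]
    exact hε.le
  obtain ⟨i, w, b1, b2, b3, b4⟩ := exists_branch S hne
  have hwN : N ≤ (freeProduct S).wordLength w := by
    by_contra! hlt
    exact b2 (hp (i, w) ⟨Set.mem_univ _, hlt.le⟩ b1)
  have h3 := f.tail_antitone hwN
  have h4 := (freeProduct S).floydDist_le_tail f b3
  have h5 := (freeProduct S).floydDist_le_tail f b4
  have h6 := (freeProduct S).floydDist_triangle f p.1 w p.2
  rw [floydDist_comm _ _ p.1 w] at h6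
  linarith

variable (f S) in
theorem isNullFamily_cosetBoundary (hn : 2 ≤ n) [∀ i, Nontrivial (A i)] :
    IsNullFamily (cosetBoundary f S) where
  isClosed := isClosed_cosetBoundary
  nonempty := cosetBoundary_nonempty
  eq_of_mem _ _ _ := eq_of_mem_cosetBoundary
  finite_diam _ := finite_le_diam_cosetBoundary
  interior_eq_empty := interior_cosetBoundary hn
  separated x y h := by
    have hv : ∀ (i : Fin n) (w : CoprodI A), firstSyllable i w⁻¹ = 1 → ∀ a,
        IsSaturatedClopen (cosetBoundary f S)
          {z : Boundary f (freeProduct S) | proj f S i w z.1 ∈ ({vertex f (S i) a} : Set _)} :=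
      fun i w hw a => isSaturatedClopen_preimage_proj hw
        ⟨isClosed_singleton, isOpen_singleton_vertex a⟩
        (Or.inr (Set.singleton_subset_iff.2 ⟨a, rfl⟩))
    by_cases hx : ∀ (i : Fin n) (w : CoprodI A), firstSyllable i w⁻¹ = 1 →
        ∃ a, proj f S i w x.1 = vertex f (S i) a
    · refine Or.inl (Subtype.ext (eq_of_proj_eq_vertex fun i w hw => ?_))
      obtain ⟨a, ha⟩ := hx i w hw
      exact ⟨a, ha, h _ (hv i w hw a) ha⟩
    push Not at hx
    obtain ⟨i, w, hw, hxa⟩ := hx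
    have hxi : proj f S i w x.1 ∉ Set.range (vertex f (S i)) := fun ⟨a, ha⟩ => hxa a ha.symm
    -- For elementary `A i` the countable completion is separated by clopen sets, so `x` and `y`
    -- have the same projection, which determines them. Otherwise `y` lies in the coset boundary of
    -- `x`, because projecting to a given vertex is a saturated clopen condition.
    by_cases hi : IsElementary (A i)
    · left
      have hxy : proj f S i w x.1 = proj f S i w y.1 := by
        by_contra hne
        have := (S i).countable_completion f hi
        obtain ⟨K, hK, hxK, hyK⟩ := exists_isClopen_of_countable hne
        exact hyK (h _ (isSaturatedClopen_preimage_proj hw hK (Or.inl hi)) hxK)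
      refine Subtype.ext ?_
      rw [← incl_proj w hxi, hxy, incl_proj w (hxy ▸ hxi)]
    · refine Or.inr ⟨⟨(i, w), hi, hw⟩, hxi, ?_⟩
      rintro ⟨a, ha⟩
      exact h _ (hv i w hw a).compl (fun hxa' => hxa a hxa') ha.symm

/-- If each boundary of a non-elementary factor of the first free product is homeomorphic to one of
the second, then the second family of boundaries of cosets has dense copies of the first. -/
theorem hasDenseCopies_cosetBoundary {m : ℕ} (hm : 2 ≤ m) {B : Fin m → Type u} [∀ j, Group (B j)]
    [∀ j, Nontrivial (B j)] {f' : FloydFunction} {S' : ∀ j, GeneratingSet (B j)}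
    (h : ∀ i, ¬ IsElementary (A i) →
      ∃ j, ¬ IsElementary (B j) ∧ Nonempty (Boundary f (S i) ≃ₜ Boundary f' (S' j))) :
    HasDenseCopies (cosetBoundary f S) (cosetBoundary f' S') := by
  rintro q U hU ⟨z, hz⟩
  obtain ⟨j, hj, ⟨e⟩⟩ := h q.1.1 q.2.1
  obtain ⟨r, hr, hball⟩ := Metric.isOpen_iff.1 hU z hz
  obtain ⟨q', rfl, -, hq'⟩ := exists_cosetBoundary_subset_ball hm hj z hr 0
  obtain ⟨z', hz'⟩ := cosetBoundary_nonempty (f := f') (S := S') q'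
  exact ⟨q', ⟨z', hz', hball (hq' hz')⟩, ⟨(cosetBoundaryHomeomorph f S q).trans
    (e.trans (cosetBoundaryHomeomorph f' S' q').symm)⟩⟩

end

end FloydCompletion

/-! ### Change of generating set for doubling Floyd functions. -/

theorem FloydFunction.IsDoubling.exists_le_mul {f : FloydFunction} (hf : f.IsDoubling) (C M : ℕ) :
    ∃ K, 0 < K ∧ ∀ a b, b ≤ M * a → f (a - C) ≤ K * f b := by
  obtain ⟨D, hD⟩ := hf
  have hD0 : 0 < D := (div_pos (f.pos 0) (f.pos _)).trans_le (hD 0)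
  obtain ⟨K, hK, h⟩ := f.exists_le_mul_of_le_add C
  refine ⟨K * D ^ M, by positivity, fun a b hab => ?_⟩
  -- Taking `p = M` suffices, as `M ≤ 2 ^ M`.
  have key : ∀ p : ℕ, f a ≤ D ^ p * f (2 ^ p * a) := by
    intro p
    induction p with
    | zero => simp
    | succ p ih =>
      refine ih.trans ?_
      rw [pow_succ, mul_assoc, pow_succ', mul_assoc 2]
      gcongr
      exact (div_le_iff₀ (f.pos _)).1 (hD _)
  have h1 : f (2 ^ M * a) ≤ f b :=
    f.antitone (hab.trans (Nat.mul_le_mul_right a Nat.lt_two_pow_self.le))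
  calc f (a - C) ≤ K * f a := h _ _ (by omega)
    _ ≤ K * (D ^ M * f b) := by
        gcongr
        exact (key M).trans (by gcongr)
    _ = K * D ^ M * f b := (mul_assoc _ _ _).symm

namespace GeneratingSet

variable {G : Type u} [Group G] (S T : GeneratingSet G)

theorem exists_wordLength_le_of_adj :
    ∃ C, ∀ g h, S.cayley.Adj g h → T.wordLength (g⁻¹ * h) ≤ C := by
  obtain ⟨C, hC⟩ := ((S.finite_wordLength_le 1).image T.wordLength).bddAbove
  exact ⟨C, fun g h hadj => hC ⟨_, (S.wordLength_inv_mul_of_adj hadj).le, rfl⟩⟩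

theorem exists_wordLength_le_mul : ∃ C, ∀ g, T.wordLength g ≤ C * S.wordLength g := by
  obtain ⟨C, hC⟩ := S.exists_wordLength_le_of_adj T
  refine ⟨C, fun g => ?_⟩
  obtain ⟨n, hn⟩ : ∃ n, S.wordLength g = n := ⟨_, rfl⟩
  induction n generalizing g with
  | zero =>
    rw [wordLength_eq_zero] at hn
    simp [hn]
  | succ n ih =>
    have hne : g ≠ 1 := by
      rintro rfl
      simp at hn
    obtain ⟨h, hadj, hh⟩ := S.exists_adj_of_ne hne
    rw [mul_one, mul_one, wordLength_inv, wordLength_inv] at hh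
    have h1 := ih h (by omega)
    have h2 := T.wordLength_mul_le h (h⁻¹ * g)
    have h3 := hC h g hadj.symm
    rw [mul_inv_cancel_left] at h2
    rw [← hh, mul_add, mul_one]
    omega

/-- For a doubling Floyd function, the Floyd metrics of two finite generating sets are bi-Lipschitz
equivalent. -/
theorem exists_floydDist_le_mul {f : FloydFunction} (hf : f.IsDoubling) :
    ∃ K, 0 ≤ K ∧ ∀ g h, T.floydDist f g h ≤ K * S.floydDist f g h := by
  obtain ⟨C, hC⟩ := S.exists_wordLength_le_of_adj T
  obtain ⟨M, hM⟩ := T.exists_wordLength_le_mul S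
  obtain ⟨K, hK, h⟩ := hf.exists_le_mul C M
  refine ⟨C * K, by positivity, S.floydDist_map_le f T f id (by positivity) fun g k hadj => ?_⟩
  have h1 := T.floydDist_mul_right_le f g (g⁻¹ * k)
  rw [mul_inv_cancel_left] at h1
  have h2 := hC g k hadj
  have h3 : f (T.wordLength g - T.wordLength (g⁻¹ * k)) ≤ f (T.wordLength g - C) :=
    f.antitone (by omega)
  have h4 : f (T.wordLength g - C) ≤ K * S.edgeLength f g k :=
    h _ _ ((min_le_left _ _).trans (hM g))
  refine h1.trans ?_
  rw [mul_assoc]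
  have h5 := f.pos (T.wordLength g - T.wordLength (g⁻¹ * k))
  gcongr
  exact h3.trans h4

end GeneratingSet

namespace FloydCompletion

/-- The identity of `G` is Lipschitz in both directions, so it extends to mutually inverse maps of
the completions that preserve vertices. -/
theorem nonempty_boundary_homeomorph {G : Type u} [Group G] {f : FloydFunction} (hf : f.IsDoubling)
    (S T : GeneratingSet G) : Nonempty (Boundary f S ≃ₜ Boundary f T) := by
  have key : ∀ (S T : GeneratingSet G) x, map f T f S id (map f S f T id x) = x :=
    fun S T => eq_of_forall_vertex ((continuous_map _).comp (continuous_map _)) continuous_id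
      fun g => by
        rw [map_vertex (φ := id) (S.exists_floydDist_le_mul T hf),
          map_vertex (φ := id) (T.exists_floydDist_le_mul S hf)]
        rfl
  have hmem : ∀ (S T : GeneratingSet G) x, x ∉ Set.range (vertex f S) →
      map f S f T id x ∉ Set.range (vertex f T) := by
    rintro S T x hx ⟨g, hg⟩
    refine hx ⟨g, ?_⟩
    rw [← key S T x, ← hg, map_vertex (φ := id) (T.exists_floydDist_le_mul S hf)]
    rfl
  exact ⟨{
    toFun x := ⟨map f S f T id x.1, hmem S T _ x.2⟩
    invFun x := ⟨map f T f S id x.1, hmem T S _ x.2⟩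
    left_inv x := Subtype.ext (key S T _)
    right_inv x := Subtype.ext (key T S _)
    continuous_toFun := ((continuous_map _).comp continuous_subtype_val).subtype_mk _
    continuous_invFun := ((continuous_map _).comp continuous_subtype_val).subtype_mk _ }⟩

/-! ### From homeomorphism types of the factors to the theorem. -/

theorem nonempty_homeomorph_of_nonElementaryTypes_subset {n m : ℕ} {A : Fin n → Type u}
    [∀ i, Group (A i)] {B : Fin m → Type u} [∀ j, Group (B j)] {f f' : FloydFunction}
    {S : ∀ i, GeneratingSet (A i)} {S' : ∀ j, GeneratingSet (B j)}
    (h : nonElementaryTypes f S ⊆ nonElementaryTypes f' S') (i : Fin n) (hi : ¬ IsElementary (A i)) :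
    ∃ j, ¬ IsElementary (B j) ∧ Nonempty (Boundary f (S i) ≃ₜ Boundary f' (S' j)) := by
  obtain ⟨j, hj, hij⟩ := h ⟨i, hi, rfl⟩
  -- `floydBoundary` and `Boundary` agree by definition.
  exact ⟨j, hj, Quotient.exact hij⟩

end FloydCompletion

open FloydCompletion in
theorem theorem6p2 {n m : ℕ} (hn : 2 ≤ n) (hm : 2 ≤ m)
    (A : Fin n → Type u) [∀ i, Group (A i)] [∀ i, Nontrivial (A i)]
    (B : Fin m → Type u) [∀ j, Group (B j)] [∀ j, Nontrivial (B j)]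
    (f f' : FloydFunction)
    (S : ∀ i, GeneratingSet (A i)) (S' : ∀ j, GeneratingSet (B j))
    (T : GeneratingSet (Monoid.CoprodI A)) (T' : GeneratingSet (Monoid.CoprodI B))
    (hT : T = GeneratingSet.freeProduct S ∨ f.IsDoubling)
    (hT' : T' = GeneratingSet.freeProduct S' ∨ f'.IsDoubling)
    (hne : (∃ i, ¬ IsElementary (A i)) ∨ ∃ j, ¬ IsElementary (B j))
    (hh : nonElementaryTypes f S = nonElementaryTypes f' S') :
    Nonempty (floydBoundary f T ≃ₜ floydBoundary f' T') := by
  have h1 : Nonempty (Boundary f T ≃ₜ Boundary f (GeneratingSet.freeProduct S)) := by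
    rcases hT with rfl | hT
    · exact ⟨Homeomorph.refl _⟩
    · exact nonempty_boundary_homeomorph hT _ _
  have h2 : Nonempty (Boundary f' (GeneratingSet.freeProduct S') ≃ₜ Boundary f' T') := by
    rcases hT' with rfl | hT'
    · exact ⟨Homeomorph.refl _⟩
    · exact nonempty_boundary_homeomorph hT' _ _
  have hAB := nonempty_homeomorph_of_nonElementaryTypes_subset hh.subset
  have hBA := nonempty_homeomorph_of_nonElementaryTypes_subset hh.superset
  -- Equality of the sets of types carries a non-elementary factor from one side to the other, so
  -- both families are nonempty.
  obtain ⟨i, hi⟩ : ∃ i, ¬ IsElementary (A i) := by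
    rcases hne with h | ⟨j, hj⟩
    · exact h
    · obtain ⟨i, hi, -⟩ := hBA j hj
      exact ⟨i, hi⟩
  obtain ⟨j, hj, -⟩ := hAB i hi
  let q : CosetIndex A := ⟨(i, 1), hi, by simp⟩
  let q' : CosetIndex B := ⟨(j, 1), hj, by simp⟩
  have : Nonempty (CosetIndex A) := ⟨q⟩
  have : Nonempty (Boundary f (GeneratingSet.freeProduct S)) := (cosetBoundary_nonempty q).nonempty
  have : Nonempty (Boundary f' (GeneratingSet.freeProduct S')) :=
    (cosetBoundary_nonempty q').nonempty
  obtain ⟨e⟩ := (isNullFamily_cosetBoundary f S hn).nonempty_homeomorph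
    (isNullFamily_cosetBoundary f' S' hm) (hasDenseCopies_cosetBoundary hm hAB)
    (hasDenseCopies_cosetBoundary hn hBA)
  obtain ⟨e₁⟩ := h1
  obtain ⟨e₂⟩ := h2
  exact ⟨e₁.trans (e.trans e₂)⟩
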